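/- Let $\mathfrak g$ be a finite-dimensional complex Lie algebra, $\mathfrak g=\mathfrak g_0+\mathfrak m$ with $\mathfrak g_0$ a subalgebra and $\mathfrak m$ an abelian ideal of dimension $p$, and let $\mathfrak r$ be the solvable radical of $\mathfrak g_0$. A *nonlinear (formal) representation* of $\mathfrak g$ in $E=\mathbb C^{p+q}$ is a linear map $X\mapsto T_X=\sum_{k\ge 0}T^k_X$ into the formal vector fields on $E$ ($T_X^k$ homogeneous of degree $k$) with $T_{[X,Y]}=[T_X,T_Y]$. Let $T$ be such a representation with $T^0_X=0$ for $X\in\mathfrak g_0$ and $T^0_X\ne0$ for $X\in\mathfrak m\setminus\{0\}$, written in coordinates $(x_1,\dots,x_p,y_1,\dots,y_q)$ of $E$ in which $T_X=\sum_{i=1}^p a_i(X)\,\partial/\partial x_i$ for $X\in\mathfrak m$, with $a_i\in\mathfrak m^*$. For a formal map $\phi$ without constant term and formal vector fields $A,B$, say that $\phi$ transforms $A$ into $B$ if $D\phi(A)=B\circ\phi$; when $\phi$ has invertible linear part this means $\phi_*A=B$. A *root* of $\mathfrak r$ is a linear form $v\in\mathfrak r^*$ such that $v(X)$ is an eigenvalue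 of $\mathrm{ad}\,X$ on $\mathfrak r$ for every $X\in\mathfrak r$. Then, after a suitable linear change of the coordinates $x$ among themselves and of the coordinates $y$ among themselves (the new coordinates are again denoted $x,y$ and the representation again $T$), the following holds. 1. There are maps $W_k:E\to E$ ($k\ge1$), homogeneous polynomial of degree $k$ and depending only on $y$, with all $y$-components of $W_1$ equal to $0$, such that the formal infinite composition $$\phi=\cdots\circ(I+W_k)\circ\cdots\circ(I+W_1)$$ (coefficientwise limit of the finite compositions) has no constant term and invertible linear part, and normalizes $T|_{\mathfrak r}$. That is, there are a nonlinear representation $T'$ of $\mathfrak g$ such that $\phi$ transforms $T_X$ into $T'_X$ for all $X\in\mathfrak g$, and linear forms $(\lambda_1,\dots,\lambda_{p+q})=(\mu_1,\dots,\mu_p,\nu_1,\dots,\nu_q)$ on $\mathfrak r$, such that for all $X\in\mathfrak r$ $$T'_X=\sum_{i,j=1}^p c_{ij}(X)\,x_j\frac{\partial}{\partial x_i}+\sum_{i=1}^p\sum_{|\alpha|\ge1}\Lambda_i^\alpha(X)\,y^\alpha\frac{\partial}{\partial x_i}+\sum_{i=1}^q\sum_{|\alpha|\ge1}\Gamma_i^\alpha(X)\,y^\alpha\frac{\partial}{\partial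 y_i},$$ where the matrix $(c_{ij}(X))$ and the matrix of the linear terms $y_j\,\partial/\partial y_i$ are upper triangular with diagonals $\mu_1(X),\dots,\mu_p(X)$ and $\nu_1(X),\dots,\nu_q(X)$, and every monomial that occurs is resonant: a monomial $z^\beta\,\partial/\partial z_i$, with $z=(x,y)$, has a nonzero coefficient for some $X\in\mathfrak r$ only if $\sum_j\beta_j\lambda_j-\lambda_i$ is a root of $\mathfrak r$. 2. Every formal infinite composition $\phi=\cdots\circ(I+W_k)\circ\cdots\circ(I+W_1)$ in which each $W_k$ is homogeneous of degree $k$ and depends only on $y$ leaves $T|_{\mathfrak m}$ invariant: it transforms $T_X$ into $T_X$ for all $X\in\mathfrak m$, and each $\partial/\partial x_i$, $i=1,\dots,p$, into itself. -/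

import Mathlib

open MvPowerSeries in
/-- A formal vector field `∑ i, A i • ∂/∂z_i` in the coordinates `z_i`, `i : ι`, with arbitrary
(possibly nonzero) constant term. The same type holds formal maps, given by their components. -/
abbrev FormalVF (ι : Type*) := ι → MvPowerSeries ι ℂ

namespace FormalVF

open MvPowerSeries

section General

variable {ι : Type*} [Fintype ι]

/-- The value `T⁰` at the origin. -/
noncomputable def constPart (A : FormalVF ι) : ι → ℂ := fun i => constantCoeff (A i)

/-- The coordinate vector field `∂/∂z_i`. -/
noncomputable def coordField [DecidableEq ι] (i : ι) : FormalVF ι := Pi.single i 1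

/-- The derivative `φ ⋆ A = Dφ(A)` of the formal map `φ` along the vector field `A`. -/
noncomputable def star (φ A : FormalVF ι) : FormalVF ι :=
  fun j => ∑ i, A i * pderiv ℂ i (φ j)

/-- The Lie bracket of formal vector fields (as derivations):
`[A, B]_j = ∑ i, (A_i ∂_i B_j - B_i ∂_i A_j)`. -/
noncomputable def bracket (A B : FormalVF ι) : FormalVF ι := star B A - star A B

/-- The composition `A ∘ φ`. It is only used for `φ` without constant term, where substitution of
power series is well defined. -/
noncomputable def comp (A φ : FormalVF ι) : FormalVF ι := fun j => subst φ (A j)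

/-- The identity map. -/
noncomputable def idMap (ι : Type*) : FormalVF ι := fun i => X i

/-- `φ` belongs to `𝒳₀(E)` (no constant term) and its linear part `φ¹` is invertible. -/
def IsFormalChange [DecidableEq ι] (φ : FormalVF ι) : Prop :=
  constPart φ = 0 ∧
    IsUnit (Matrix.of fun i j => coeff (Finsupp.single j 1) (φ i) : Matrix ι ι ℂ).det

/-- `φ` transforms `A` into `B`: `φ ⋆ A = B ∘ φ`. For invertible `φ` this says
`φ ⋆ A ∘ φ⁻¹ = B`. -/
def Transforms (φ A B : FormalVF ι) : Prop := star φ A = comp B φ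

/-- `A` is homogeneous of degree `k`, that is, it is an element of `L(⊗ₛᵏ E, E)`. -/
def IsHomogeneous (k : ℕ) (A : FormalVF ι) : Prop :=
  ∀ i d, coeff d (A i) ≠ 0 → d.degree = k

/-- The finite composition `(I + W_k) ∘ ⋯ ∘ (I + W_1)`. -/
noncomputable def partialComp (W : ℕ → FormalVF ι) : ℕ → FormalVF ι
  | 0 => idMap ι
  | k + 1 => comp (idMap ι + W (k + 1)) (partialComp W k)

/-- `φ = ⋯ ∘ (I + W_k) ∘ ⋯ ∘ (I + W_1)`: each coefficient of `φ` is the eventual value of the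
corresponding coefficient of the finite compositions. -/
def IsInfiniteComp (W : ℕ → FormalVF ι) (φ : FormalVF ι) : Prop :=
  ∀ i d, ∀ᶠ k in Filter.atTop, coeff d (partialComp W k i) = coeff d (φ i)

/-- A nonlinear formal representation of the Lie algebra `g` in `ℂ^ι`: a linear map
`X ↦ T_X` into the formal vector fields with `T_[X,Y] = [T_X, T_Y]`. -/
def IsNonlinearRep {g : Type*} [LieRing g] [LieAlgebra ℂ g] (T : g →ₗ[ℂ] FormalVF ι) : Prop :=
  ∀ X Y : g, T ⁅X, Y⁆ = bracket (T X) (T Y)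

/-- `φ` is an equivalence from the nonlinear representation `T` to the nonlinear
representation `T'`. -/
def IsEquivalence {g : Type*} [LieRing g] [LieAlgebra ℂ g] [DecidableEq ι] (φ : FormalVF ι)
    (T T' : g →ₗ[ℂ] FormalVF ι) : Prop :=
  IsFormalChange φ ∧ IsNonlinearRep T' ∧ ∀ X, Transforms φ (T X) (T' X)

end General

section Split

variable {p q : ℕ}

/-- The monomial `x^β y^α` of exponent `d = (β, α)` involves only the `y` coordinates. Here
`Sum.inl i` is the index of `x_i` and `Sum.inr j` the index of `y_j`. -/
def YOnly (d : Fin p ⊕ Fin q →₀ ℕ) : Prop := ∀ i : Fin p, d (Sum.inl i) = 0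

/-- All components of `A` depend only on the `y` coordinates. -/
def DependsOnlyOnY (A : FormalVF (Fin p ⊕ Fin q)) : Prop :=
  ∀ i d, coeff d (A i) ≠ 0 → YOnly d

/-- The linear change of coordinates `(x, y) ↦ (P x, Q y)`. -/
noncomputable def linearChange (P : Matrix (Fin p) (Fin p) ℂ) (Q : Matrix (Fin q) (Fin q) ℂ) :
    FormalVF (Fin p ⊕ Fin q) :=
  Sum.elim (fun i => ∑ j, P i j • X (Sum.inl j)) (fun i => ∑ j, Q i j • X (Sum.inr j))

end Split

end FormalVF

section Resonance

variable {r : Type*} [LieRing r] [LieAlgebra ℂ r]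

/-- A root of the solvable Lie algebra `r`: a linear form on `r` whose value at each `X` is an
eigenvalue of `ad X`. (The linear forms on the diagonal of a simultaneous triangularization of
`ad r` have this property; conversely a form with this property agrees with one of these finitely
many forms at each point of `r`, hence is one of them, as `r` is not a finite union of proper
subspaces.) -/
def IsLieRoot (v : Module.Dual ℂ r) : Prop :=
  ∀ X : r, Module.End.HasEigenvalue (LieAlgebra.ad ℂ r X) (v X)

/-- The pair `(α, j)` is resonant for the weights `wt`: the linear form
`∑ i, α_i wt_i - wt_j` is a root of `r`. -/
def IsResonant {ι : Type*} [Fintype ι] (wt : ι → Module.Dual ℂ r) (α : ι →₀ ℕ) (j : ι) : Prop :=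
  IsLieRoot ((∑ i, (α i : ℂ) • wt i) - wt j)

open MvPowerSeries FormalVF in
/-- The family `T_X`, `X ∈ r`, of formal vector fields in the coordinates `(x, y)` is in normal
form with weights `wt = (μ_1, …, μ_p, ν_1, …, ν_q)`:
`T_X = ∑ c_ij(X) x_j ∂/∂x_i + ∑ Λ^α_i(X) y^α ∂/∂x_i + ∑ Γ^α_i(X) y^α ∂/∂y_i`, `|α| ≥ 1`,
where the matrices `(c_ij(X))` and `(Γ^{1_j}_i(X))` are upper triangular with diagonals
`μ_i(X)` and `ν_i(X)`, and where all the monomials that occur are resonant. -/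
structure IsNormalForm {p q : ℕ} (T : r → FormalVF (Fin p ⊕ Fin q))
    (wt : Fin p ⊕ Fin q → Module.Dual ℂ r) : Prop where
  constPart_eq_zero : ∀ X, constPart (T X) = 0
  x_shape : ∀ X i d, coeff d (T X (Sum.inl i)) ≠ 0 →
    (∃ j, d = Finsupp.single (Sum.inl j) 1) ∨ YOnly d
  y_shape : ∀ X i d, coeff d (T X (Sum.inr i)) ≠ 0 → YOnly d
  x_triangular : ∀ X i j, j < i →
    coeff (Finsupp.single (Sum.inl j) 1) (T X (Sum.inl i)) = 0
  y_triangular : ∀ X i j, j < i →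
    coeff (Finsupp.single (Sum.inr j) 1) (T X (Sum.inr i)) = 0
  diagonal : ∀ X i, coeff (Finsupp.single i 1) (T X i) = wt i X
  resonant : ∀ X i d, coeff d (T X i) ≠ 0 → IsResonant wt d i

end Resonance

/-! The map `a : m → ℂ^p` is injective and `dim m = p`, so `T` maps `m` onto all constant fields in
the x-directions. Since `m` is an ideal, bracketing any `T_X` with `∂/∂x_i` gives again a constant
x-field (`MapsOntoXFields.exists_pderiv_eq`). Hence the y-components of `T_X` do not involve `x`,
and the x-components are a linear form in `x` with constant coefficients plus a series in `y`. Any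
equivalence that permutes the constant x-fields linearly preserves this shape
(`MapsOntoXFields.of_transforms`), so only triangularity and resonance remain to be arranged.

The linear part of `T_X` is block triangular, and Lie's theorem, applied to its two diagonal blocks,
gives the weights `μ` and `ν`. The forms `∑ α_j λ_j - λ_i - χ_k`, with `χ_k` the diagonal forms of
`ad`, are countable in number, so some `H` in the radical is a zero of none of them except those
that vanish identically (`exists_forall_dual_apply_ne_zero`). It then suffices to normalize the
single field of `H`.

Formal power series are filtered by a grading of the coordinates in which each `T_X` acts diagonally
on leading terms. For such an operator every coordinate `z_i` can be completed to a series `φ_i` on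
which the powers of `T_H - λ_i(H)` tend to zero, with corrections in monomials of weight other than
`λ_i(H)` (`IsTriangularWith.exists_generalized_eigenvector`). Suppose the linear change has been
adapted to the generalized eigenspaces of `H`. Then the corrections can be kept in invariant spaces
in which the only monomials involving `x` have exactly the excluded weight, and so do the linear
y-monomials allowed in the y-components. Therefore `φ - I` depends only on `y` and has no linear
terms in its y-components (`IsNormalizable.exists_normalizing_map`). Such a `φ` is an infinite
composition of the required kind (`exists_isInfiniteComp`).

After transport by `φ` the coordinates are themselves generalized eigenvectors of `T'_H`. If `Y` is
a generalized eigenvector of `ad H` for `a`, the Leibniz rule puts `T'_Y z_i` in the eigenspace for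
`a + λ_i(H)`, so only monomials of that weight occur in it (`weight_eq_of_generalized_eigenvector`).
As `a = χ_k(H)`, genericity of `H` turns this equality of numbers into an equality of linear forms,
which is resonance (`isResonant_of_generic`).

The second statement only needs that the x-derivatives of `φ` are those of the identity
(`IsYShift.transforms_xField`). -/

/-! ### Triangular operators on a filtered product space and their generalized eigenvectors. -/

section TriangularOperators

variable {V M : Type*} [AddCommGroup V] [Module ℂ V]

/-- The vectors all of whose coordinates of grade less than `s` vanish. -/
def gradeFiltration (c : V ≃ₗ[ℂ] (M → ℂ)) (gr : M → ℕ) (s : ℕ) : Submodule ℂ V where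
  carrier := {v | ∀ m, gr m < s → c v m = 0}
  add_mem' := by
    intro v w hv hw m hm
    simp [hv m hm, hw m hm]
  zero_mem' := by simp
  smul_mem' := by
    intro a v hv m hm
    simp [hv m hm]

/-- `D` acts on the leading coordinates, with respect to the filtration by grade, as the diagonal
operator with eigenvalues `wt`. -/
def IsTriangularWith (c : V ≃ₗ[ℂ] (M → ℂ)) (gr : M → ℕ) (D : Module.End ℂ V) (wt : M → ℂ) :
    Prop :=
  ∀ s, ∀ v ∈ gradeFiltration c gr s, ∀ m, gr m ≤ s → c (D v) m = wt m * c v m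

/-- The vectors with coordinates supported in `K`. -/
def coordSupported (c : V ≃ₗ[ℂ] (M → ℂ)) (K : Set M) : Submodule ℂ V where
  carrier := {v | ∀ m, m ∉ K → c v m = 0}
  add_mem' := by
    intro v w hv hw m hm
    simp [hv m hm, hw m hm]
  zero_mem' := by simp
  smul_mem' := by
    intro a v hv m hm
    simp [hv m hm]

variable {c : V ≃ₗ[ℂ] (M → ℂ)} {gr : M → ℕ}

theorem gradeFiltration_antitone : Antitone (gradeFiltration c gr) :=
  fun _ _ hst _ hv m hm => hv m (hm.trans_le hst)

theorem mem_gradeFiltration_zero (v : V) : v ∈ gradeFiltration c gr 0 :=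
  fun _ hm => absurd hm (Nat.not_lt_zero _)

theorem eq_zero_of_forall_mem_gradeFiltration {v : V} (h : ∀ s, v ∈ gradeFiltration c gr s) :
    v = 0 := by
  apply c.injective
  ext m
  simpa using h (gr m + 1) m (Nat.lt_succ_self _)

/-- The filtration by grade is complete. -/
theorem exists_limit_of_gradeFiltration (s : ℕ) (u : ℕ → V)
    (hu : ∀ n, u (n + 1) - u n ∈ gradeFiltration c gr (s + n)) :
    ∃ v, ∀ n, v - u n ∈ gradeFiltration c gr (s + n) := by
  have key : ∀ n k, u (n + k) - u n ∈ gradeFiltration c gr (s + n) := by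
    intro n k
    induction k with
    | zero => simp
    | succ k ih =>
      have := Submodule.add_mem _
        (gradeFiltration_antitone (show s + n ≤ s + (n + k) by omega) (hu (n + k))) ih
      simpa [add_assoc] using this
  -- From index `gr m + 1` on the coordinate `m` no longer changes, even when `s = 0`.
  refine ⟨c.symm fun m => c (u (gr m + 1)) m, fun n m hm => ?_⟩
  simp only [map_sub, Pi.sub_apply, LinearEquiv.apply_symm_apply]
  rcases le_total n (gr m + 1) with h | h
  · obtain ⟨k, hk⟩ := Nat.exists_eq_add_of_le h
    have := key n k m hm
    rw [← hk] at this
    simpa using this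
  · obtain ⟨k, rfl⟩ := Nat.exists_eq_add_of_le h
    have := key (gr m + 1) k m (by omega)
    simp only [map_sub, Pi.sub_apply] at this
    linear_combination -this

namespace IsTriangularWith

variable {D : Module.End ℂ V} {wt : M → ℂ}

theorem mapsTo (h : IsTriangularWith c gr D wt) {s : ℕ} {v : V}
    (hv : v ∈ gradeFiltration c gr s) : D v ∈ gradeFiltration c gr s := by
  intro m hm
  rw [h s v hv m hm.le, hv m hm, mul_zero]

theorem sub_algebraMap (h : IsTriangularWith c gr D wt) (a : ℂ) :
    IsTriangularWith c gr (D - algebraMap ℂ (Module.End ℂ V) a) (fun m => wt m - a) := by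
  intro s v hv m hm
  simp [h s v hv m hm, sub_mul]

theorem pow (h : IsTriangularWith c gr D wt) (n : ℕ) :
    IsTriangularWith c gr (D ^ n) (fun m => wt m ^ n) := by
  induction n with
  | zero => intro s v _ m _; simp
  | succ n ih =>
    intro s v hv m hm
    rw [pow_succ', Module.End.mul_apply, h s _ (ih.mapsTo hv) m hm, ih s v hv m hm]
    ring

/-- A unipotent operator leaves the lowest nonzero coordinates unchanged, so it reflects the
filtration as well as preserving it. -/
theorem mem_of_map_mem (h : IsTriangularWith c gr D fun _ => 1) {s : ℕ} {v : V}
    (hv : D v ∈ gradeFiltration c gr s) : v ∈ gradeFiltration c gr s := by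
  suffices ∀ t ≤ s, v ∈ gradeFiltration c gr t from this s le_rfl
  intro t
  induction t with
  | zero => exact fun _ => mem_gradeFiltration_zero v
  | succ t ih =>
    intro ht m hm
    have h1 := h t v (ih (by omega)) m (by omega)
    rw [hv m (by omega)] at h1
    simpa using h1.symm

/-- `1 - D` raises the grade. For surjectivity, the Neumann iteration `u ↦ u + (g - D u)` improves
the error by one grade at each step and converges by completeness. -/
theorem bijective (h : IsTriangularWith c gr D fun _ => 1) : Function.Bijective D := by
  constructor
  · rw [injective_iff_map_eq_zero]
    intro v hv
    exact eq_zero_of_forall_mem_gradeFiltration fun s =>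
      h.mem_of_map_mem (c := c) (gr := gr) (by rw [hv]; exact Submodule.zero_mem _)
  · intro g
    let u : ℕ → V := fun n => Nat.rec 0 (fun _ v => v + (g - D v)) n
    have hu : ∀ n, u (n + 1) = u n + (g - D (u n)) := fun n => rfl
    have hmem : ∀ n, g - D (u n) ∈ gradeFiltration c gr n := by
      intro n
      induction n with
      | zero => exact mem_gradeFiltration_zero _
      | succ n ih =>
        intro m hm
        have := h n _ ih m (by omega)
        rw [hu]
        simp only [map_add, map_sub, Pi.sub_apply, Pi.add_apply, one_mul] at this ⊢
        linear_combination -this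
    obtain ⟨v, hv⟩ := exists_limit_of_gradeFiltration (c := c) (gr := gr) 0 u (fun n => by
      rw [hu]; simpa using hmem n)
    refine ⟨v, (sub_eq_zero.mp (eq_zero_of_forall_mem_gradeFiltration
      (c := c) (gr := gr) fun s => ?_)).symm⟩
    have h1 := hv s
    rw [zero_add] at h1
    have h2 := Submodule.sub_mem _ (hmem s) (h.mapsTo h1)
    simpa using h2

/-- A leading vector of weight `a` can be completed to a generalized eigenvector of a triangular
operator, with corrections in coordinates of weights other than `a`. -/
theorem exists_generalized_eigenvector (h : IsTriangularWith c gr D wt) (K : Set M)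
    (hK : ∀ v ∈ coordSupported c K, D v ∈ coordSupported c K) {s : ℕ} {a : ℂ} {v₀ : V}
    (hv₀ : v₀ ∈ gradeFiltration c gr s) (hv₀K : v₀ ∈ coordSupported c K)
    (hlead : ∀ m, gr m = s → c v₀ m ≠ 0 → wt m = a) :
    ∃ v ∈ coordSupported c K, v - v₀ ∈ gradeFiltration c gr (s + 1) ∧
      (∀ m, c (v - v₀) m ≠ 0 → wt m ≠ a) ∧
      ∀ n, ((D - algebraMap ℂ (Module.End ℂ V) a) ^ n) v ∈ gradeFiltration c gr (s + n) := by
  classical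
  have hT := h.sub_algebraMap a
  have hKpow : ∀ n, ∀ v ∈ coordSupported c K,
      ((D - algebraMap ℂ (Module.End ℂ V) a) ^ n) v ∈ coordSupported c K := by
    intro n
    induction n with
    | zero => intro v hv; simpa using hv
    | succ n ih =>
      intro v hv
      rw [pow_succ', Module.End.mul_apply]
      simp only [LinearMap.sub_apply, Module.algebraMap_end_apply]
      exact Submodule.sub_mem _ (hK _ (ih v hv)) (Submodule.smul_mem _ _ (ih v hv))
  let P : ℕ → V → Prop := fun n v => v ∈ coordSupported c K ∧
    v - v₀ ∈ gradeFiltration c gr (s + 1) ∧ (∀ m, c (v - v₀) m ≠ 0 → wt m ≠ a) ∧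
    ((D - algebraMap ℂ (Module.End ℂ V) a) ^ n) v ∈ gradeFiltration c gr (s + n)
  have step : ∀ n, 1 ≤ n → ∀ v, P n v →
      ∃ v', P (n + 1) v' ∧ v' - v ∈ gradeFiltration c gr (s + n) := by
    rintro n hn v ⟨h1, h2, h3, h4⟩
    set u := ((D - algebraMap ℂ (Module.End ℂ V) a) ^ n) v with hu
    -- On coordinates of grade `s + n`, `(D - a) ^ n` acts on `w` as multiplication by `(wt m - a) ^
    -- n`. Subtracting `w` thus removes the obstruction at weights other than `a`; at weight `a` one
    -- further factor `D - a` removes it.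
    let w : V := c.symm fun m => if gr m = s + n ∧ wt m ≠ a then c u m / (wt m - a) ^ n else 0
    have hw : ∀ m, c w m = if gr m = s + n ∧ wt m ≠ a then c u m / (wt m - a) ^ n else 0 := by
      intro m; simp [w]
    have hwF : w ∈ gradeFiltration c gr (s + n) := by
      intro m hm
      rw [hw, if_neg (by omega)]
    have hwK : w ∈ coordSupported c K := by
      intro m hm
      rw [hw, hKpow n v h1 m hm]
      simp
    have hsub : v - w - v₀ = (v - v₀) - w := by abel
    refine ⟨v - w, ⟨Submodule.sub_mem _ h1 hwK, ?_, ?_, ?_⟩, ?_⟩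
    · rw [hsub]
      exact Submodule.sub_mem _ h2 (gradeFiltration_antitone (by omega) hwF)
    · intro m hm hma
      rw [hsub, map_sub, Pi.sub_apply, hw m, if_neg (by simp [hma]), sub_zero] at hm
      exact h3 m hm hma
    · have hF : ((D - algebraMap ℂ (Module.End ℂ V) a) ^ n) (v - w) ∈ gradeFiltration c gr (s + n) := by
        rw [map_sub]
        exact Submodule.sub_mem _ h4 ((hT.pow n).mapsTo hwF)
      intro m hm
      rw [pow_succ', Module.End.mul_apply, hT _ _ hF m (by omega)]
      rcases eq_or_lt_of_le (show gr m ≤ s + n by omega) with hm' | hm'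
      · by_cases hma : wt m = a
        · simp [hma]
        · rw [map_sub, map_sub, Pi.sub_apply, (hT.pow n) _ w hwF m hm'.le, hw m,
            if_pos ⟨hm', hma⟩, ← hu, mul_div_cancel₀ _ (pow_ne_zero _ (sub_ne_zero.mpr hma)),
            sub_self, mul_zero]
      · rw [hF m hm', mul_zero]
    · simpa using hwF
  -- The iteration starts with exponent 1: the leading coordinates of `v₀` already have weight `a`,
  -- so no correction in grade `s` is needed.
  have h0 : P 1 v₀ := by
    refine ⟨hv₀K, by simp, by simp, ?_⟩
    intro m hm
    rw [pow_one, hT s _ hv₀ m (by omega)]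
    by_cases hc : c v₀ m = 0
    · simp [hc]
    · rcases eq_or_lt_of_le (show gr m ≤ s by omega) with hm' | hm'
      · simp [hlead m hm' hc]
      · exact absurd (hv₀ m hm') hc
  let seq : ∀ n : ℕ, {v // P (n + 1) v} := fun n => Nat.rec ⟨v₀, h0⟩
    (fun n v => ⟨(step (n + 1) (by omega) v.1 v.2).choose,
      (step (n + 1) (by omega) v.1 v.2).choose_spec.1⟩) n
  have hseq : ∀ n, (seq (n + 1)).1 - (seq n).1 ∈ gradeFiltration c gr (s + 1 + n) := by
    intro n
    have := (step (n + 1) (by omega) (seq n).1 (seq n).2).choose_spec.2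
    rw [add_assoc, add_comm 1 n]
    exact this
  obtain ⟨v, hv⟩ := exists_limit_of_gradeFiltration (s + 1) (fun n => (seq n).1) hseq
  have hcoord : ∀ m, c v m = c (seq (gr m)).1 m := by
    intro m
    have := hv (gr m) m (by omega)
    simpa [sub_eq_zero] using this
  refine ⟨v, ?_, ?_, ?_, ?_⟩
  · intro m hm
    rw [hcoord]
    exact (seq (gr m)).2.1 m hm
  · have := Submodule.add_mem _ (gradeFiltration_antitone (by omega) (hv 0)) (seq 0).2.2.1
    simpa using this
  · intro m hm
    refine (seq (gr m)).2.2.2.1 m ?_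
    simpa [hcoord m] using hm
  · intro n
    cases n with
    | zero =>
      have h1 := Submodule.add_mem _ (gradeFiltration_antitone (by omega : s ≤ s + 1 + 0) (hv 0))
        (Submodule.add_mem _ (gradeFiltration_antitone (by omega : s ≤ s + 1) (seq 0).2.2.1) hv₀)
      simpa using h1
    | succ n =>
      have h1 := (hT.pow (n + 1)).mapsTo (hv n)
      have h2 := Submodule.add_mem _ (gradeFiltration_antitone (by omega : s + (n + 1) ≤ _) h1)
        (seq n).2.2.2.2
      simpa using h2

end IsTriangularWith

/-- The topological generalized eigenspace of `D` for the eigenvalue `a`, with respect to the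
filtration by grade. -/
def filteredEigenspace (c : V ≃ₗ[ℂ] (M → ℂ)) (gr : M → ℕ) (D : Module.End ℂ V) (a : ℂ) : Set V :=
  {v | ∀ s, ∃ n, ((D - algebraMap ℂ (Module.End ℂ V) a) ^ n) v ∈ gradeFiltration c gr s}

namespace IsTriangularWith

variable {D : Module.End ℂ V} {wt : M → ℂ}

theorem pow_mem_of_le (h : IsTriangularWith c gr D wt) {a : ℂ} {v : V} {s n k : ℕ} (hnk : n ≤ k)
    (hv : ((D - algebraMap ℂ (Module.End ℂ V) a) ^ n) v ∈ gradeFiltration c gr s) :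
    ((D - algebraMap ℂ (Module.End ℂ V) a) ^ k) v ∈ gradeFiltration c gr s := by
  obtain ⟨l, rfl⟩ := Nat.exists_eq_add_of_le' hnk
  rw [pow_add, Module.End.mul_apply]
  exact ((h.sub_algebraMap a).pow l).mapsTo hv

theorem smul_mem_filteredEigenspace {a : ℂ} {v : V} (b : ℂ)
    (hv : v ∈ filteredEigenspace c gr D a) : b • v ∈ filteredEigenspace c gr D a := by
  intro s
  obtain ⟨n, hn⟩ := hv s
  exact ⟨n, by rw [map_smul]; exact Submodule.smul_mem _ _ hn⟩

theorem add_mem_filteredEigenspace (h : IsTriangularWith c gr D wt) {a : ℂ} {v w : V}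
    (hv : v ∈ filteredEigenspace c gr D a) (hw : w ∈ filteredEigenspace c gr D a) :
    v + w ∈ filteredEigenspace c gr D a := by
  intro s
  obtain ⟨n, hn⟩ := hv s
  obtain ⟨k, hk⟩ := hw s
  refine ⟨max n k, ?_⟩
  rw [map_add]
  exact Submodule.add_mem _ (h.pow_mem_of_le (le_max_left _ _) hn)
    (h.pow_mem_of_le (le_max_right _ _) hk)

/-- If all coordinate vectors are generalized eigenvectors of a triangular operator `D`, then the
generalized eigenvectors for `a` only involve the coordinates of weight `a`. -/
theorem weight_eq_of_mem_filteredEigenspace [DecidableEq M] (h : IsTriangularWith c gr D wt)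
    (hfin : ∀ s, {m | gr m < s}.Finite)
    (hpure : ∀ m, c.symm (Pi.single m 1) ∈ filteredEigenspace c gr D (wt m)) {a : ℂ} {v : V}
    (hv : v ∈ filteredEigenspace c gr D a) {m : M} (hm : c v m ≠ 0) : wt m = a := by
  induction hs : gr m using Nat.strong_induction_on generalizing m with
  | _ s ih =>
    subst hs
    let S := (hfin (gr m)).toFinset
    -- `f` cancels the coordinates of `v` of grade below `gr m`. By induction these have weight `a`,
    -- so `v + f` is still a generalized eigenvector, and the coordinate `m` becomes a leading one.
    let f : V := ∑ k ∈ S, -c v k • c.symm (Pi.single k 1)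
    have hf : ∀ k, c f k = if k ∈ S then -c v k else 0 := by
      intro k
      simp only [f, map_sum, map_smul, LinearEquiv.apply_symm_apply, Finset.sum_apply,
        Pi.smul_apply, smul_eq_mul, Pi.single_apply, mul_ite, mul_one, mul_zero]
      rw [Finset.sum_ite_eq]
    have hfa : v + f ∈ filteredEigenspace c gr D a := by
      refine h.add_mem_filteredEigenspace hv ?_
      refine Finset.sum_induction _ (fun w => w ∈ filteredEigenspace c gr D a)
        (fun _ _ => h.add_mem_filteredEigenspace) (fun s => ⟨0, by simp⟩) ?_
      intro k hk
      by_cases hck : c v k = 0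
      · simp only [hck, neg_zero, zero_smul]
        exact fun s => ⟨0, by simp⟩
      · have := hpure k
        rw [ih (gr k) (by simpa [S] using hk) hck rfl] at this
        exact smul_mem_filteredEigenspace _ this
    have hmem : v + f ∈ gradeFiltration c gr (gr m) := by
      intro k hk
      rw [map_add, Pi.add_apply, hf, if_pos (by simpa [S] using hk), add_neg_cancel]
    obtain ⟨n, hn⟩ := hfa (gr m + 1)
    have h1 := hn m (by omega)
    rw [((h.sub_algebraMap a).pow n) _ _ hmem m le_rfl, map_add, Pi.add_apply, hf,
      if_neg (by simp [S]), add_zero] at h1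
    rcases mul_eq_zero.mp h1 with h2 | h2
    · exact sub_eq_zero.mp (pow_eq_zero_iff (n := n) (fun h0 => by simp [h0] at h2) |>.mp h2)
    · exact absurd h2 hm

end IsTriangularWith

/-- Powers of operators satisfying a Leibniz rule with respect to a bilinear operation. -/
theorem pow_apply_mem_of_leibniz {A B C : Type*} [AddCommGroup A] [Module ℂ A] [AddCommGroup B]
    [Module ℂ B] [AddCommGroup C] [Module ℂ C] (f : A → B → C) {dA : Module.End ℂ A}
    {dB : Module.End ℂ B} {dC : Module.End ℂ C}
    (hleib : ∀ x y, dC (f x y) = f (dA x) y + f x (dB y)) {N : Submodule ℂ C} {NA : Submodule ℂ A}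
    {NB : Submodule ℂ B} (hN : ∀ z ∈ N, dC z ∈ N) (hA : ∀ x ∈ NA, ∀ y, f x y ∈ N)
    (hB : ∀ x, ∀ y ∈ NB, f x y ∈ N) (n k : ℕ) (x : A) (y : B) (hx : (dA ^ n) x ∈ NA)
    (hy : (dB ^ k) y ∈ NB) : (dC ^ (n + k)) (f x y) ∈ N := by
  have hpow : ∀ (n : ℕ), ∀ z ∈ N, (dC ^ n) z ∈ N := by
    intro n
    induction n with
    | zero => intro z hz; simpa using hz
    | succ n ih =>
      intro z hz
      rw [pow_succ', Module.End.mul_apply]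
      exact hN _ (ih z hz)
  induction hnk : n + k generalizing n k x y with
  | zero =>
    obtain ⟨rfl, rfl⟩ : n = 0 ∧ k = 0 := by omega
    exact hA x (by simpa using hx) y
  | succ l ih =>
    rcases n with _ | n
    · exact hpow _ _ (hA x (by simpa using hx) y)
    rcases k with _ | k
    · exact hpow _ _ (hB x y (by simpa using hy))
    -- One application of the Leibniz rule lowers `n` in one term and `k` in the other, which
    -- replaces the binomial expansion.
    rw [pow_succ, Module.End.mul_apply, hleib, map_add]
    refine Submodule.add_mem _ (ih n (k + 1) (dA x) y ?_ hy (by omega))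
      (ih (n + 1) k x (dB y) hx ?_ (by omega))
    · rwa [pow_succ, Module.End.mul_apply] at hx
    · rwa [pow_succ, Module.End.mul_apply] at hy

end TriangularOperators

/-! ### Conjugation of triangular operators by unipotent ones. -/

section Conjugation

variable {V M : Type*} [AddCommGroup V] [Module ℂ V] {c : V ≃ₗ[ℂ] (M → ℂ)} {gr : M → ℕ}
  {D D' Φ : Module.End ℂ V} {wt : M → ℂ}

namespace IsTriangularWith

theorem conj (h : IsTriangularWith c gr D wt) (hΦ : IsTriangularWith c gr Φ fun _ => 1)
    (hconj : ∀ v, Φ (D' v) = D (Φ v)) : IsTriangularWith c gr D' wt := by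
  intro s v hv m hm
  have h1 : D' v ∈ gradeFiltration c gr s :=
    hΦ.mem_of_map_mem (by rw [hconj]; exact h.mapsTo (hΦ.mapsTo hv))
  have h2 := hΦ s _ h1 m hm
  rw [hconj, h s _ (hΦ.mapsTo hv) m hm, hΦ s v hv m hm] at h2
  simpa using h2.symm

/-- `Φ` intertwines the powers of `D' - a` and `D - a` and reflects the filtration, so convergence
to zero pulls back along it. -/
theorem mem_filteredEigenspace_of_conj (hΦ : IsTriangularWith c gr Φ fun _ => 1)
    (hconj : ∀ v, Φ (D' v) = D (Φ v)) {a : ℂ} {v : V} (hv : Φ v ∈ filteredEigenspace c gr D a) :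
    v ∈ filteredEigenspace c gr D' a := by
  have hpow : ∀ (n : ℕ) (v : V), Φ (((D' - algebraMap ℂ (Module.End ℂ V) a) ^ n) v) =
      ((D - algebraMap ℂ (Module.End ℂ V) a) ^ n) (Φ v) := by
    intro n
    induction n with
    | zero => simp
    | succ n ih =>
      intro v
      rw [pow_succ, pow_succ, Module.End.mul_apply, Module.End.mul_apply, ih]
      simp [hconj]
  intro s
  obtain ⟨n, hn⟩ := hv s
  exact ⟨n, hΦ.mem_of_map_mem (by rwa [hpow])⟩

theorem map_mem_filteredEigenspace (h : IsTriangularWith c gr D wt) {a : ℂ} {v : V}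
    (hv : v ∈ filteredEigenspace c gr D a) : D v ∈ filteredEigenspace c gr D a := by
  intro s
  obtain ⟨n, hn⟩ := hv s
  refine ⟨n, ?_⟩
  have h1 : Commute ((D - algebraMap ℂ (Module.End ℂ V) a) ^ n) D :=
    Commute.pow_left ((Commute.refl D).sub_left (Algebra.commutes a D)) n
  rw [← Module.End.mul_apply, h1.eq, Module.End.mul_apply]
  exact h.mapsTo hn

end IsTriangularWith

theorem isTriangularWith_of_basis {n : ℕ} (b : Module.Basis (Fin n) ℂ V) {D : Module.End ℂ V}
    {wt : Fin n → ℂ} (htri : ∀ i j, j < i → b.repr (D (b i)) j = 0)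
    (hdiag : ∀ i, b.repr (D (b i)) i = wt i) :
    IsTriangularWith b.equivFun Fin.val D wt := by
  intro s v hv m hm
  have hv' : ∀ i : Fin n, (i : ℕ) < s → b.repr v i = 0 := fun i hi => hv i hi
  simp only [Module.Basis.equivFun_apply]
  conv_lhs => rw [← b.sum_repr v]
  simp only [map_sum, map_smul, Finsupp.coe_finsetSum, Finset.sum_apply, Finsupp.smul_apply,
    smul_eq_mul]
  rw [Finset.sum_eq_single m, hdiag, mul_comm]
  · intro i _ him
    rcases lt_or_gt_of_ne him with h | h
    · rw [hv' i (lt_of_lt_of_le h hm), zero_mul]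
    · rw [htri i m h, mul_zero]
  · simp

end Conjugation

/-! ### Lie's theorem, roots, and generic elements of a solvable Lie algebra. -/

section Lie

variable {r : Type*} [LieRing r] [LieAlgebra ℂ r]

/-- **Lie's theorem**, in the form of a simultaneous triangularization. -/
theorem LieModule.exists_lower_triangular_basis [LieAlgebra.IsSolvable r] {V : Type*}
    [AddCommGroup V] [Module ℂ V] [FiniteDimensional ℂ V] [LieRingModule r V] [LieModule ℂ r V]
    {n : ℕ} (hn : Module.finrank ℂ V = n) :
    ∃ (b : Module.Basis (Fin n) ℂ V) (χ : Fin n → Module.Dual ℂ r),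
      (∀ (X : r) i j, i < j → b.repr ⁅X, b i⁆ j = 0) ∧
        ∀ (X : r) i, b.repr ⁅X, b i⁆ i = χ i X := by
  induction n generalizing V with
  | zero => exact ⟨Module.finBasisOfFinrankEq ℂ V hn, Fin.elim0, fun _ i => i.elim0,
      fun _ i => i.elim0⟩
  | succ n ih =>
    have : Nontrivial V := Module.nontrivial_of_finrank_pos (R := ℂ) (by omega)
    obtain ⟨χ₀, hχ₀⟩ := LieModule.exists_nontrivial_weightSpace_of_isSolvable ℂ r V
    obtain ⟨⟨v, hv⟩, hv0⟩ := exists_ne (0 : LieModule.weightSpace V χ₀)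
    rw [LieModule.mem_weightSpace] at hv
    have hv0' : v ≠ 0 := fun h => hv0 (by ext; exact h)
    let N : LieSubmodule ℂ r V :=
      { toSubmodule := Submodule.span ℂ {v}
        lie_mem := by
          intro x m hm
          obtain ⟨a, rfl⟩ := Submodule.mem_span_singleton.mp hm
          rw [lie_smul, hv]
          exact Submodule.smul_mem _ _
            (Submodule.smul_mem _ _ (Submodule.mem_span_singleton_self v)) }
    have hfr : Module.finrank ℂ (V ⧸ N) = n := by
      have h1 := Submodule.finrank_quotient_add_finrank (N : Submodule ℂ V)
      have h2 : Module.finrank ℂ (N : Submodule ℂ V) = 1 := finrank_span_singleton hv0'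
      have h3 : Module.finrank ℂ (V ⧸ N) = Module.finrank ℂ (V ⧸ (N : Submodule ℂ V)) := rfl
      omega
    obtain ⟨b, χ, hb, hχ⟩ := ih hfr
    obtain ⟨N', hN'⟩ := Submodule.exists_isCompl (N : Submodule ℂ V)
    let e : (V ⧸ N) ≃ₗ[ℂ] N' := Submodule.quotientEquivOfIsCompl (N : Submodule ℂ V) N' hN'
    -- The common eigenvector comes first, followed by lifts of a triangular basis of the quotient;
    -- coordinates with index at least 1 can then be computed in the quotient.
    let B : Module.Basis (Fin (n + 1)) ℂ V := Module.Basis.mkFinCons v (b.map e)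
      (by
        intro c x hx hcx
        have h1 : c • v ∈ (N : Submodule ℂ V) ⊓ N' := by
          refine ⟨Submodule.smul_mem _ _ (Submodule.mem_span_singleton_self v), ?_⟩
          rw [eq_neg_of_add_eq_zero_left hcx]
          exact Submodule.neg_mem _ hx
        rw [hN'.inf_eq_bot, Submodule.mem_bot] at h1
        exact (smul_eq_zero.mp h1).resolve_right hv0')
      (by
        intro z
        obtain ⟨x, hx, y, hy, rfl⟩ := Submodule.mem_sup.mp
          (hN'.sup_eq_top ▸ Submodule.mem_top : z ∈ (N : Submodule ℂ V) ⊔ N')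
        obtain ⟨a, rfl⟩ := Submodule.mem_span_singleton.mp hx
        exact ⟨-a, by simpa using hy⟩)
    have hB0 : B 0 = v := by simp [B]
    have hBs : ∀ i, B (Fin.succ i) = (e (b i) : V) := by intro i; simp [B]
    have hmk : ∀ i, (LieSubmodule.Quotient.mk (e (b i) : V) : V ⧸ N) = b i := by
      intro i
      exact Submodule.mk_quotientEquivOfIsCompl_apply hN' _
    have hmkv : (LieSubmodule.Quotient.mk v : V ⧸ N) = 0 :=
      (LieSubmodule.Quotient.mk_eq_zero N).mpr (Submodule.mem_span_singleton_self v)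
    have hrepr : ∀ (u : V) (j : Fin n),
        B.repr u (Fin.succ j) = b.repr (LieSubmodule.Quotient.mk u : V ⧸ N) j := by
      intro u j
      have : (B.coord (Fin.succ j)) = (b.coord j).comp
          (LieSubmodule.Quotient.mk' N : V →ₗ[ℂ] V ⧸ N) := by
        refine B.ext fun k => ?_
        refine Fin.cases ?_ (fun k => ?_) k
        · rw [Module.Basis.coord_apply, Module.Basis.repr_self, LinearMap.comp_apply, hB0]
          change _ = b.repr (LieSubmodule.Quotient.mk v : V ⧸ N) j
          rw [hmkv]
          simp
        · rw [Module.Basis.coord_apply, Module.Basis.repr_self, LinearMap.comp_apply, hBs]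
          change _ = b.repr (LieSubmodule.Quotient.mk (e (b k) : V) : V ⧸ N) j
          rw [hmk, Module.Basis.repr_self]
          simp [Finsupp.single_apply]
      exact LinearMap.congr_fun this u
    have hlie : ∀ (X : r) i, (LieSubmodule.Quotient.mk ⁅X, (e (b i) : V)⁆ : V ⧸ N) = ⁅X, b i⁆ := by
      intro X i
      conv_rhs => rw [← hmk i]
      rfl
    refine ⟨B, Fin.cons χ₀ χ, ?_, ?_⟩
    · intro X i j hij
      obtain ⟨j, rfl⟩ := Fin.exists_succ_eq.mpr (Fin.ne_zero_of_lt hij)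
      rw [hrepr]
      refine Fin.cases ?_ (fun i hij => ?_) i hij
      · intro _
        rw [hB0, hv]
        change b.repr ((LieSubmodule.Quotient.mk' N : V →ₗ[ℂ] V ⧸ N) _) j = 0
        rw [map_smul]
        change b.repr (_ • (LieSubmodule.Quotient.mk v : V ⧸ N)) j = 0
        simp [hmkv]
      · rw [hBs, hlie]
        exact hb X i j (Fin.succ_lt_succ_iff.mp hij)
    · intro X i
      refine Fin.cases ?_ (fun i => ?_) i
      · rw [hB0, hv, map_smul, ← hB0, Module.Basis.repr_self]
        simp
      · rw [hrepr, hBs, hlie, hχ]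
        simp

theorem exists_triangular_basis [LieAlgebra.IsSolvable r] {V : Type*} [AddCommGroup V]
    [Module ℂ V] [FiniteDimensional ℂ V] (ρ : r →ₗ[ℂ] Module.End ℂ V)
    (hρ : ∀ X Y v, ρ ⁅X, Y⁆ v = ρ X (ρ Y v) - ρ Y (ρ X v)) {n : ℕ}
    (hn : Module.finrank ℂ V = n) :
    ∃ (b : Module.Basis (Fin n) ℂ V) (χ : Fin n → Module.Dual ℂ r),
      (∀ X i j, j < i → b.repr (ρ X (b i)) j = 0) ∧ ∀ X i, b.repr (ρ X (b i)) i = χ i X := by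
  let _ : LieRingModule r V := 
    { bracket := fun X v => ρ X v
      add_lie := fun X Y v => by simp
      lie_add := fun X v w => map_add (ρ X) v w
      leibniz_lie := fun X Y v => by
        change ρ X (ρ Y v) = ρ ⁅X, Y⁆ v + ρ Y (ρ X v)
        rw [hρ]; abel }
  let _ : LieModule ℂ r V :=
    { smul_lie := fun a X v => by change ρ (a • X) v = a • ρ X v; simp
      lie_smul := fun a X v => map_smul (ρ X) a v }
  obtain ⟨b, χ, hb, hχ⟩ := LieModule.exists_lower_triangular_basis (r := r) hn
  -- Reversing the order makes the image of `b i` involve only indices `≥ i`, so that the operators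
  -- preserve the filtration by grade.
  refine ⟨b.reindex Fin.revPerm, fun i => χ (Fin.rev i), ?_, ?_⟩
  · intro X i j hij
    have hbr : ∀ v, ρ X v = ⁅X, v⁆ := fun v => rfl
    simpa [hbr] using hb X (Fin.rev i) (Fin.rev j) (Fin.rev_lt_rev.mpr hij)
  · intro X i
    have hbr : ∀ v, ρ X v = ⁅X, v⁆ := fun v => rfl
    simpa [hbr] using hχ X (Fin.rev i)

/-- A simultaneous triangularization can be adapted to the generalized eigenspaces of one of the
operators, without changing the diagonal. -/
theorem exists_adapted_triangular_basis {V : Type*} [AddCommGroup V] [Module ℂ V]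
    (ρ : r →ₗ[ℂ] Module.End ℂ V) {n : ℕ} (b : Module.Basis (Fin n) ℂ V)
    {χ : Fin n → Module.Dual ℂ r} (htri : ∀ X i j, j < i → b.repr (ρ X (b i)) j = 0)
    (hdiag : ∀ X i, b.repr (ρ X (b i)) i = χ i X) (H : r) :
    ∃ b' : Module.Basis (Fin n) ℂ V,
      (∀ X i j, j < i → b'.repr (ρ X (b' i)) j = 0) ∧
      (∀ X i, b'.repr (ρ X (b' i)) i = χ i X) ∧
      ∀ i j, b'.repr (ρ H (b' i)) j ≠ 0 → χ j H = χ i H := by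
  have hT : ∀ X, IsTriangularWith b.equivFun Fin.val (ρ X) (fun i => χ i X) := fun X =>
    isTriangularWith_of_basis b (htri X) (hdiag X)
  have hex : ∀ i : Fin n, ∃ v, v - b i ∈ gradeFiltration b.equivFun Fin.val (i + 1) ∧
      ∀ k, ((ρ H - algebraMap ℂ (Module.End ℂ V) (χ i H)) ^ k) v ∈
        gradeFiltration b.equivFun Fin.val (i + k) := by
    intro i
    obtain ⟨v, -, h1, -, h2⟩ := (hT H).exists_generalized_eigenvector Set.univ
      (fun v _ m hm => absurd (Set.mem_univ m) hm) (s := i) (a := χ i H) (v₀ := b i)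
      (fun m hm => by
        have : m ≠ i := fun h => by simp [h] at hm
        simp [this.symm])
      (fun m hm => absurd (Set.mem_univ m) hm)
      (fun m hm _ => by rw [Fin.ext hm])
    exact ⟨v, h1, h2⟩
  choose v hv hvk using hex
  -- `U` sends each basis vector to its completed generalized eigenvector. It is unipotent, so
  -- conjugation by it changes neither triangularity nor the diagonal of any `ρ X`.
  let U : Module.End ℂ V := b.constr ℂ v
  have hUb : ∀ i, U (b i) = v i := fun i => b.constr_basis ℂ v i
  have hvr : ∀ i j, j ≤ i → b.repr (v i) j = b.repr (b i) j := by
    intro i j hij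
    have := hv i j (by omega)
    simpa [sub_eq_zero] using this
  have hU : IsTriangularWith b.equivFun Fin.val U fun _ => 1 := by
    refine isTriangularWith_of_basis b (fun i j hij => ?_) (fun i => ?_)
    · rw [hUb, hvr i j hij.le]
      simp [hij.ne']
    · rw [hUb, hvr i i le_rfl]
      simp
  let e : V ≃ₗ[ℂ] V := LinearEquiv.ofBijective U hU.bijective
  have he : ∀ u, e u = U u := fun u => rfl
  let ρ' : r → Module.End ℂ V := fun X => e.symm.toLinearMap ∘ₗ ρ X ∘ₗ e.toLinearMap
  have hconj : ∀ X u, U (ρ' X u) = ρ X (U u) := by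
    intro X u
    rw [← he, ← he]
    simp [ρ']
  have hT' : ∀ X, IsTriangularWith b.equivFun Fin.val (ρ' X) (fun i => χ i X) :=
    fun X => (hT X).conj hU (hconj X)
  have hrepr : ∀ X i j, (b.map e).repr (ρ X ((b.map e) i)) j = b.equivFun (ρ' X (b i)) j := by
    intro X i j
    simp [ρ']
  have hbi : ∀ i : Fin n, b i ∈ gradeFiltration b.equivFun Fin.val i := fun i m hm => by
    have : m ≠ i := fun h => by simp [h] at hm
    simp [this.symm]
  have hpure : ∀ i, b i ∈ filteredEigenspace b.equivFun Fin.val (ρ' H) (χ i H) := by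
    intro i
    refine hU.mem_filteredEigenspace_of_conj (hconj H) fun s => ⟨s, ?_⟩
    rw [hUb]
    exact gradeFiltration_antitone (by omega) (hvk i s)
  refine ⟨b.map e, ?_, ?_, ?_⟩
  · intro X i j hij
    rw [hrepr, hT' X _ _ (hbi i) j hij.le]
    simp [hij.ne']
  · intro X i
    rw [hrepr, hT' X _ _ (hbi i) i le_rfl]
    simp
  · intro i j hij
    rw [hrepr] at hij
    refine (hT' H).weight_eq_of_mem_filteredEigenspace (fun s => Set.toFinite _) (fun m => ?_)
      ((hT' H).map_mem_filteredEigenspace (hpure i)) hij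
    have : b.equivFun.symm (Pi.single m 1) = b m := by
      rw [LinearEquiv.symm_apply_eq]
      ext k
      simp [Pi.single_apply, eq_comm]
    rw [this]
    exact hpure m

/-- In a simultaneous triangularization of `ad`, the characteristic polynomial of `ad X` is the
product of the factors given by the diagonal entries at `X`. -/
theorem exists_lieRoots [LieAlgebra.IsSolvable r] [FiniteDimensional ℂ r] :
    ∃ (n : ℕ) (χ : Fin n → Module.Dual ℂ r), (∀ i, IsLieRoot (χ i)) ∧
      ∀ X a, Module.End.HasEigenvalue (LieAlgebra.ad ℂ r X) a → ∃ i, χ i X = a := by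
  obtain ⟨b, χ, hb, hχ⟩ := exists_triangular_basis
    (LieAlgebra.ad ℂ r : r →ₗ[ℂ] Module.End ℂ r) (fun X Y v => by simp) rfl
  have key : ∀ X a, Module.End.HasEigenvalue (LieAlgebra.ad ℂ r X) a ↔ ∃ i, χ i X = a := by
    intro X a
    rw [Module.End.hasEigenvalue_iff_isRoot_charpoly, ← LinearMap.charpoly_toMatrix _ b,
      -- With this ordering of the basis the matrix of `ad X` is lower triangular, hence the
      -- transpose.
      ← Matrix.charpoly_transpose, Matrix.charpoly_of_isUpperTriangular]
    · simp only [Matrix.transpose_apply, LinearMap.toMatrix_apply, Polynomial.IsRoot.def,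
        Polynomial.eval_prod, Finset.prod_eq_zero_iff, Finset.mem_univ, true_and]
      refine exists_congr fun i => ?_
      rw [← hχ X i, Polynomial.eval_sub, Polynomial.eval_X, Polynomial.eval_C, sub_eq_zero]
      exact eq_comm
    · intro i j hij
      rw [Matrix.transpose_apply, LinearMap.toMatrix_apply]
      exact hb X i j hij
  exact ⟨_, χ, fun i X => (key X _).mpr ⟨i, rfl⟩, fun X a => (key X a).mp⟩

/-- Restricted to the moment curve `t ↦ ∑ t^k b_k`, a nonzero form becomes a nonzero polynomial with
finitely many roots, and countably many such root sets do not cover `ℂ`. -/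
theorem exists_forall_dual_apply_ne_zero {V : Type*} [AddCommGroup V] [Module ℂ V]
    [FiniteDimensional ℂ V] {ι : Type*} [Countable ι] (f : ι → Module.Dual ℂ V) :
    ∃ v, ∀ i, f i ≠ 0 → f i v ≠ 0 := by
  let b := Module.finBasis ℂ V
  let P : ι → Polynomial ℂ := fun i =>
    ∑ k : Fin (Module.finrank ℂ V), Polynomial.monomial (k : ℕ) (f i (b k))
  have hP : ∀ i, f i ≠ 0 → P i ≠ 0 := by
    intro i hi h0
    refine hi (b.ext fun k => ?_)
    have := congrArg (fun p => Polynomial.coeff p (k : ℕ)) h0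
    simpa [P, Polynomial.finsetSum_coeff, Polynomial.coeff_monomial, Fin.val_inj] using this
  have hcount : (⋃ i, {t : ℂ | P i ≠ 0 ∧ (P i).IsRoot t}).Countable := by
    refine Set.countable_iUnion fun i => ?_
    by_cases h : P i = 0
    · simp [h]
    · exact ((Polynomial.finite_setOfPred_isRoot h).subset fun t ht => ht.2).countable
  obtain ⟨t, ht⟩ : ∃ t, t ∉ ⋃ i, {t : ℂ | P i ≠ 0 ∧ (P i).IsRoot t} := by
    by_contra! h
    exact not_countable_complex ((Set.eq_univ_of_forall h) ▸ hcount)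
  refine ⟨∑ k : Fin (Module.finrank ℂ V), t ^ (k : ℕ) • b k, fun i hi h0 => ht ?_⟩
  refine Set.mem_iUnion.mpr ⟨i, hP i hi, ?_⟩
  rw [Polynomial.IsRoot.def, ← h0]
  simp [P, Polynomial.eval_finsetSum, mul_comm]

end Lie

/-! ### Power series filtered by weight: derivations and substitution. -/

namespace FormalVF

open MvPowerSeries

section PowerSeries

variable {ι : Type*} [Fintype ι]

/-- A formal power series as the family of its coefficients. -/
def coeffEquiv (ι : Type*) : MvPowerSeries ι ℂ ≃ₗ[ℂ] ((ι →₀ ℕ) → ℂ) where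
  toFun f d := coeff d f
  invFun g := fun d => g d
  left_inv f := by ext d; rfl
  right_inv g := by ext d; rfl
  map_add' f g := by ext d; simp
  map_smul' a f := by ext d; simp

omit [Fintype ι] in
@[simp] theorem coeffEquiv_apply (f : MvPowerSeries ι ℂ) (d : ι →₀ ℕ) :
    coeffEquiv ι f d = coeff d f := rfl

omit [Fintype ι] in
theorem coeffEquiv_symm_single [DecidableEq ι] (d : ι →₀ ℕ) :
    (coeffEquiv ι).symm (Pi.single d 1) = monomial d 1 := by
  rw [LinearEquiv.symm_apply_eq]
  ext e
  simp [coeff_monomial, Pi.single_apply]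

/-- The power series whose monomials all have `w`-weight at least `s`. -/
noncomputable abbrev weightFiltration (w : ι → ℕ) (s : ℕ) : Submodule ℂ (MvPowerSeries ι ℂ) :=
  gradeFiltration (coeffEquiv ι) (Finsupp.weight w) s

variable {w : ι → ℕ}

theorem mul_mem_weightFiltration {s t : ℕ} {f g : MvPowerSeries ι ℂ}
    (hf : f ∈ weightFiltration w s) (hg : g ∈ weightFiltration w t) :
    f * g ∈ weightFiltration w (s + t) := by
  classical
  intro d hd
  rw [coeffEquiv_apply, coeff_mul]
  refine Finset.sum_eq_zero fun e he => ?_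
  rw [Finset.HasAntidiagonal.mem_antidiagonal] at he
  rw [← he, map_add] at hd
  rcases lt_or_ge (Finsupp.weight w e.1) s with h | h
  · rw [show coeff e.1 f = 0 from hf _ h, zero_mul]
  · rw [show coeff e.2 g = 0 from hg _ (by omega), mul_zero]

theorem mul_mem_weightFiltration_left {s : ℕ} {f : MvPowerSeries ι ℂ} (g : MvPowerSeries ι ℂ)
    (hf : f ∈ weightFiltration w s) : f * g ∈ weightFiltration w s := by
  simpa using mul_mem_weightFiltration hf (mem_gradeFiltration_zero g)

theorem monomial_mem_weightFiltration (d : ι →₀ ℕ) (a : ℂ) :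
    monomial d a ∈ weightFiltration w (Finsupp.weight w d) := by
  classical
  intro e he
  rw [coeffEquiv_apply, coeff_monomial, if_neg]
  rintro rfl
  exact lt_irrefl _ he

theorem X_mem_weightFiltration (i : ι) : (X i : MvPowerSeries ι ℂ) ∈ weightFiltration w (w i) := by
  have := monomial_mem_weightFiltration (w := w) (Finsupp.single i 1) 1
  simpa [Finsupp.weight_single, X_def] using this

theorem prod_sub_prod_mem_weightFiltration {κ : Type*} (S : Finset κ)
    {f g : κ → MvPowerSeries ι ℂ} {s : κ → ℕ} (hg : ∀ k ∈ S, g k ∈ weightFiltration w (s k))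
    (hfg : ∀ k ∈ S, f k - g k ∈ weightFiltration w (s k + 1)) :
    ∏ k ∈ S, g k ∈ weightFiltration w (∑ k ∈ S, s k) ∧
    ∏ k ∈ S, f k - ∏ k ∈ S, g k ∈ weightFiltration w (∑ k ∈ S, s k + 1) := by
  classical
  induction S using Finset.induction_on with
  | empty => exact ⟨by simpa using mem_gradeFiltration_zero _, by simp⟩
  | insert a S ha ih =>
    obtain ⟨h1, h2⟩ := ih (fun k hk => hg k (Finset.mem_insert_of_mem hk))
      (fun k hk => hfg k (Finset.mem_insert_of_mem hk))
    have h3 := hg a (Finset.mem_insert_self a S)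
    have h4 := hfg a (Finset.mem_insert_self a S)
    rw [Finset.prod_insert ha, Finset.prod_insert ha, Finset.sum_insert ha]
    refine ⟨mul_mem_weightFiltration h3 h1, ?_⟩
    have h5 : f a ∈ weightFiltration w (s a) := by
      have := Submodule.add_mem _ (gradeFiltration_antitone (Nat.le_succ _) h4) h3
      simpa using this
    have h6 : f a * ∏ k ∈ S, f k - g a * ∏ k ∈ S, g k =
        f a * (∏ k ∈ S, f k - ∏ k ∈ S, g k) + (f a - g a) * ∏ k ∈ S, g k := by ring
    rw [h6]
    refine Submodule.add_mem _ ?_ ?_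
    · exact gradeFiltration_antitone (by omega) (mul_mem_weightFiltration h5 h2)
    · exact gradeFiltration_antitone (by omega) (mul_mem_weightFiltration h4 h1)

theorem pow_sub_pow_mem_weightFiltration {f g : MvPowerSeries ι ℂ} {s : ℕ}
    (hg : g ∈ weightFiltration w s) (hfg : f - g ∈ weightFiltration w (s + 1)) (n : ℕ) :
    g ^ n ∈ weightFiltration w (n * s) ∧ f ^ n - g ^ n ∈ weightFiltration w (n * s + 1) := by
  have := prod_sub_prod_mem_weightFiltration (Finset.range n) (f := fun _ => f) (g := fun _ => g)
    (s := fun _ => s) (fun _ _ => hg) (fun _ _ => hfg)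
  simpa using this

theorem pow_mem_weightFiltration {f : MvPowerSeries ι ℂ} {s : ℕ}
    (hf : f ∈ weightFiltration w s) (n : ℕ) : f ^ n ∈ weightFiltration w (n * s) :=
  (pow_sub_pow_mem_weightFiltration (f := f) hf (by rw [sub_self]; exact Submodule.zero_mem _) n).1

theorem prod_pow_mem_weightFiltration {φ : FormalVF ι} (h : ∀ j, φ j ∈ weightFiltration w (w j))
    (d : ι →₀ ℕ) :
    (d.prod fun j n => φ j ^ n) ∈ weightFiltration w (Finsupp.weight w d) := by
  have := (prod_sub_prod_mem_weightFiltration (w := w) d.support (f := fun j => φ j ^ d j)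
    (g := fun j => φ j ^ d j) (s := fun j => d j * w j)
    (fun j _ => pow_mem_weightFiltration (h j) _)
    (fun j _ => by rw [sub_self]; exact Submodule.zero_mem _)).1
  rwa [Finsupp.weight_apply, Finsupp.prod, Finsupp.sum]

theorem prod_pow_sub_monomial_mem_weightFiltration {φ : FormalVF ι} {d : ι →₀ ℕ}
    (h : ∀ j ∈ d.support, φ j - X j ∈ weightFiltration w (w j + 1)) :
    (d.prod fun j n => φ j ^ n) - monomial d 1 ∈
      weightFiltration w (Finsupp.weight w d + 1) := by
  have := (prod_sub_prod_mem_weightFiltration (w := w) d.support (f := fun j => φ j ^ d j)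
    (g := fun j => X j ^ d j) (s := fun j => d j * w j)
    (fun j _ => pow_mem_weightFiltration (X_mem_weightFiltration j) _)
    (fun j hj => (pow_sub_pow_mem_weightFiltration (X_mem_weightFiltration j) (h j hj) _).2)).2
  rw [Finsupp.weight_apply, Finsupp.prod, Finsupp.sum, monomial_one_eq]
  exact this

theorem hasSubst_of_constPart {φ : FormalVF ι} (h : constPart φ = 0) : HasSubst φ :=
  hasSubst_of_constantCoeff_zero fun i => congrFun h i

theorem subst_mem_weightFiltration {φ : FormalVF ι} (hφ : HasSubst φ)
    (h : ∀ j, φ j ∈ weightFiltration w (w j)) {s : ℕ} {f : MvPowerSeries ι ℂ}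
    (hf : f ∈ weightFiltration w s) : (subst φ f : MvPowerSeries ι ℂ) ∈ weightFiltration w s := by
  intro e he
  rw [coeffEquiv_apply, coeff_subst hφ]
  refine finsum_eq_zero_of_forall_eq_zero fun d => ?_
  rcases lt_or_ge (Finsupp.weight w d) s with hd | hd
  · rw [show coeff d f = 0 from hf _ hd, zero_smul]
  · rw [show coeff e (d.prod fun j n => φ j ^ n) = 0 from
      prod_pow_mem_weightFiltration h d _ (by omega), smul_zero]

/-- Substitution of a near-identity map does not change leading terms. Closeness to the identity is
demanded only for variables occurring in `f`, since the finite compositions may have a nontrivial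
linear part in their x-components. -/
theorem coeff_subst_eq_coeff {φ : FormalVF ι} (hφ : HasSubst φ) {s : ℕ} {f : MvPowerSeries ι ℂ}
    (hf : f ∈ weightFiltration w s)
    (h : ∀ d, coeff d f ≠ 0 → ∀ j ∈ d.support, φ j - X j ∈ weightFiltration w (w j + 1))
    {e : ι →₀ ℕ} (he : Finsupp.weight w e ≤ s) :
    coeff e (subst φ f : MvPowerSeries ι ℂ) = coeff e f := by
  classical
  rw [coeff_subst hφ, finsum_eq_single _ e]
  · by_cases hfe : coeff e f = 0
    · simp [hfe]
    · have := prod_pow_sub_monomial_mem_weightFiltration (h e hfe) e (Nat.lt_succ_self _)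
      rw [coeffEquiv_apply, map_sub, coeff_monomial_same, sub_eq_zero] at this
      rw [this, smul_eq_mul, mul_one]
  · intro d hde
    by_cases hfd : coeff d f = 0
    · simp [hfd]
    · have hd : s ≤ Finsupp.weight w d := by
        by_contra hlt
        exact hfd (hf d (by omega))
      have := prod_pow_sub_monomial_mem_weightFiltration (h d hfd) e (by omega)
      rw [coeffEquiv_apply, map_sub, coeff_monomial_ne hde.symm, sub_zero] at this
      rw [this, smul_zero]

/-- Substitution of `φ` as a linear map. -/
noncomputable def substLinear {φ : FormalVF ι} (hφ : HasSubst φ) :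
    Module.End ℂ (MvPowerSeries ι ℂ) :=
  (substAlgHom (R := ℂ) hφ).toLinearMap

omit [Fintype ι] in
@[simp] theorem substLinear_apply {φ : FormalVF ι} (hφ : HasSubst φ) (f : MvPowerSeries ι ℂ) :
    substLinear hφ f = subst φ f := by
  simp [substLinear]

theorem isTriangularWith_substLinear {φ : FormalVF ι} (hφ : HasSubst φ)
    (h : ∀ j, φ j - X j ∈ weightFiltration w (w j + 1)) :
    IsTriangularWith (coeffEquiv ι) (Finsupp.weight w) (substLinear hφ) fun _ => 1 := by
  intro s f hf d hd
  rw [one_mul, substLinear_apply]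
  exact coeff_subst_eq_coeff hφ hf (fun _ _ j _ => h j) hd

/-- The derivation `∑ i, A i ∂/∂z_i` of a formal vector field `A`. -/
noncomputable def derivation (A : FormalVF ι) :
    Derivation ℂ (MvPowerSeries ι ℂ) (MvPowerSeries ι ℂ) :=
  ∑ i, A i • pderiv ℂ i

theorem derivation_apply (A : FormalVF ι) (f : MvPowerSeries ι ℂ) :
    derivation A f = ∑ i, A i * pderiv ℂ i f := by
  simp only [derivation, ← Derivation.coeFnAddMonoidHom_apply, map_sum, Finset.sum_apply]
  rfl

theorem star_apply (φ A : FormalVF ι) (j : ι) : star φ A j = derivation A (φ j) :=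
  (derivation_apply A _).symm

theorem derivation_X [DecidableEq ι] (A : FormalVF ι) (j : ι) : derivation A (X j) = A j := by
  rw [derivation_apply, Finset.sum_eq_single j]
  · simp
  · intro i _ hij
    rw [pderiv_X_of_ne hij.symm, mul_zero]
  · simp

theorem derivation_add (A B : FormalVF ι) (f : MvPowerSeries ι ℂ) :
    derivation (A + B) f = derivation A f + derivation B f := by
  simp [derivation_apply, add_mul, Finset.sum_add_distrib]

theorem derivation_sub (A B : FormalVF ι) (f : MvPowerSeries ι ℂ) :
    derivation (A - B) f = derivation A f - derivation B f := by
  simp [derivation_apply, sub_mul, Finset.sum_sub_distrib]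

theorem derivation_smul (a : ℂ) (A : FormalVF ι) (f : MvPowerSeries ι ℂ) :
    derivation (a • A) f = a • derivation A f := by
  simp [derivation_apply, Finset.smul_sum]

omit [Fintype ι] in
theorem pderiv_comm [DecidableEq ι] (i j : ι) (f : MvPowerSeries ι ℂ) :
    pderiv ℂ i (pderiv ℂ j f) = pderiv ℂ j (pderiv ℂ i f) := by
  ext d
  rw [coeff_pderiv, coeff_pderiv, coeff_pderiv, coeff_pderiv, add_right_comm]
  by_cases hij : i = j
  · rw [hij]
  · simp [hij, Ne.symm hij]
    ring

theorem derivation_bracket [DecidableEq ι] (A B : FormalVF ι) (f : MvPowerSeries ι ℂ) :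
    derivation (bracket A B) f =
      derivation A (derivation B f) - derivation B (derivation A f) := by
  -- The second-order part is symmetric in `A` and `B`, so it cancels in the commutator.
  have key : ∀ A B : FormalVF ι, derivation A (derivation B f) =
      derivation (star B A) f + ∑ i, ∑ j, A i * (B j * pderiv ℂ i (pderiv ℂ j f)) := by
    intro A B
    simp only [derivation_apply, map_sum, Derivation.leibniz, smul_eq_mul, star, Finset.mul_sum,
      Finset.sum_mul, Finset.sum_add_distrib]
    rw [add_comm]
    congr 1
    · exact Finset.sum_congr rfl fun i _ => Finset.sum_congr rfl fun j _ => by ring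
    · rw [Finset.sum_comm]
      exact Finset.sum_congr rfl fun i _ => Finset.sum_congr rfl fun j _ => by ring
  rw [bracket, derivation_sub, key A B, key B A,
    Finset.sum_comm (f := fun i j => B i * (A j * pderiv ℂ i (pderiv ℂ j f)))]
  have : ∑ i, ∑ j, A i * (B j * pderiv ℂ i (pderiv ℂ j f)) =
      ∑ i, ∑ j, B j * (A i * pderiv ℂ j (pderiv ℂ i f)) :=
    Finset.sum_congr rfl fun i _ => Finset.sum_congr rfl fun j _ => by
      rw [pderiv_comm j i]; ring
  rw [this]
  ring

theorem pderiv_mem_weightFiltration (i : ι) {s : ℕ} {f : MvPowerSeries ι ℂ}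
    (hf : f ∈ weightFiltration w s) : pderiv ℂ i f ∈ weightFiltration w (s - w i) := by
  intro d hd
  rw [coeffEquiv_apply, coeff_pderiv,
    show coeff (d + Finsupp.single i 1) f = 0 from hf _ ?_, zero_mul]
  rw [map_add, Finsupp.weight_single]
  simp only [one_smul]
  omega

omit [Fintype ι] in
theorem coeff_X_mul_pderiv [DecidableEq ι] (i : ι) (d : ι →₀ ℕ) (f : MvPowerSeries ι ℂ) :
    coeff d (X i * pderiv ℂ i f) = d i * coeff d f := by
  rw [X_def, coeff_monomial_mul]
  split_ifs with h
  · have hd : d - Finsupp.single i 1 + Finsupp.single i 1 = d := tsub_add_cancel_of_le h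
    have h1 : (((d - Finsupp.single i 1 : ι →₀ ℕ) i : ℕ) : ℂ) + 1 = d i := by
      rw [← Nat.cast_add_one]
      congr 1
      conv_rhs => rw [← hd]
      simp
    rw [coeff_pderiv, hd, h1]
    ring
  · have : d i = 0 := by
      by_contra h0
      exact h (Finsupp.single_le_iff.mpr (Nat.one_le_iff_ne_zero.mpr h0))
    simp [this]

/-- A formal vector field with diagonal leading part acts triangularly on power series. -/
theorem isTriangularWith_derivation [DecidableEq ι] {A : FormalVF ι} {lam : ι → ℂ}
    (h : ∀ i, A i - lam i • X i ∈ weightFiltration w (w i + 1)) :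
    IsTriangularWith (coeffEquiv ι) (Finsupp.weight w) (derivation A : Module.End ℂ _)
      (Finsupp.weight lam) := by
  intro s f hf d hd
  -- The diagonal Euler field multiplies each monomial by its weight. The remainder raises the
  -- grade: `∂_i` loses at most `w i`, its coefficient gains at least `w i + 1`, and truncation of
  -- `s - w i` does no harm.
  have h1 : derivation A f = ∑ i, (A i - lam i • X i) * pderiv ℂ i f +
      ∑ i, lam i • (X i * pderiv ℂ i f) := by
    rw [derivation_apply, ← Finset.sum_add_distrib]
    exact Finset.sum_congr rfl fun i _ => by rw [sub_mul, smul_mul_assoc, sub_add_cancel]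
  have h2 : ∑ i, (A i - lam i • X i) * pderiv ℂ i f ∈ weightFiltration w (s + 1) :=
    Submodule.sum_mem _ fun i _ => gradeFiltration_antitone (by omega)
      (mul_mem_weightFiltration (h i) (pderiv_mem_weightFiltration i hf))
  have h3 := h2 d (by omega)
  rw [coeffEquiv_apply] at h3
  change coeff d (derivation A f) = _ * coeff d f
  rw [h1, map_add, h3, zero_add, map_sum, Finsupp.weight_eq_sum, Finset.sum_mul]
  refine Finset.sum_congr rfl fun i _ => ?_
  rw [coeff_smul, coeff_X_mul_pderiv, nsmul_eq_mul]
  ring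

theorem mul_mem_filteredEigenspace {D : Derivation ℂ (MvPowerSeries ι ℂ) (MvPowerSeries ι ℂ)}
    {wt : (ι →₀ ℕ) → ℂ}
    (hD : IsTriangularWith (coeffEquiv ι) (Finsupp.weight w) (D : Module.End ℂ _) wt) {a b : ℂ}
    {f g : MvPowerSeries ι ℂ}
    (hf : f ∈ filteredEigenspace (coeffEquiv ι) (Finsupp.weight w) (D : Module.End ℂ _) a)
    (hg : g ∈ filteredEigenspace (coeffEquiv ι) (Finsupp.weight w) (D : Module.End ℂ _) b) :
    f * g ∈ filteredEigenspace (coeffEquiv ι) (Finsupp.weight w) (D : Module.End ℂ _) (a + b) := by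
  intro s
  obtain ⟨n, hn⟩ := hf s
  obtain ⟨k, hk⟩ := hg s
  refine ⟨n + k, pow_apply_mem_of_leibniz (fun f g : MvPowerSeries ι ℂ => f * g) ?_
    (fun z hz => (hD.sub_algebraMap _).mapsTo hz)
    (fun x hx y => mul_mem_weightFiltration_left y hx)
    (fun x y hy => mul_comm y x ▸ mul_mem_weightFiltration_left x hy) n k f g hn hk⟩
  intro x y
  simp only [LinearMap.sub_apply, Derivation.coeFn_coe, Module.algebraMap_end_apply,
    Derivation.leibniz, smul_eq_mul, sub_mul, mul_sub, add_smul, smul_mul_assoc, mul_smul_comm]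
  ring

/-- Eigenvalues add under products by the Leibniz rule, so it is enough to know that the coordinates
are generalized eigenvectors. -/
theorem monomial_mem_filteredEigenspace
    {D : Derivation ℂ (MvPowerSeries ι ℂ) (MvPowerSeries ι ℂ)} {wt : (ι →₀ ℕ) → ℂ} {lam : ι → ℂ}
    (hD : IsTriangularWith (coeffEquiv ι) (Finsupp.weight w) (D : Module.End ℂ _) wt)
    (hX : ∀ i, X i ∈
      filteredEigenspace (coeffEquiv ι) (Finsupp.weight w) (D : Module.End ℂ _) (lam i))
    (d : ι →₀ ℕ) : monomial d 1 ∈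
      filteredEigenspace (coeffEquiv ι) (Finsupp.weight w) (D : Module.End ℂ _)
        (Finsupp.weight lam d) := by
  have hone : (1 : MvPowerSeries ι ℂ) ∈
      filteredEigenspace (coeffEquiv ι) (Finsupp.weight w) (D : Module.End ℂ _) 0 := by
    intro s
    exact ⟨1, by simp⟩
  induction d using Finsupp.induction_linear with
  | zero => simpa using hone
  | add d e hd he =>
    have := mul_mem_filteredEigenspace hD hd he
    rwa [monomial_mul_monomial, one_mul, ← map_add] at this
  | single i n =>
    rw [← X_pow_eq, Finsupp.weight_single]
    induction n with
    | zero => simpa using hone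
    | succ n ih =>
      rw [pow_succ, succ_nsmul]
      exact mul_mem_filteredEigenspace hD ih (hX i)

/-- The chain rule for substitution into formal power series. -/
theorem pderiv_subst {φ : FormalVF ι} (hφ : constPart φ = 0) (i : ι) (f : MvPowerSeries ι ℂ) :
    pderiv ℂ i (subst φ f : MvPowerSeries ι ℂ) =
      ∑ j, subst φ (pderiv ℂ j f) * pderiv ℂ i (φ j) := by
  classical
  have hs := hasSubst_of_constPart hφ
  have hpoly : ∀ p : MvPolynomial ι ℂ, pderiv ℂ i (subst φ (p : MvPowerSeries ι ℂ)) =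
      ∑ j, subst φ (pderiv ℂ j (p : MvPowerSeries ι ℂ)) * pderiv ℂ i (φ j) := by
    intro p
    simp only [← substLinear_apply hs]
    induction p using MvPolynomial.induction_on with
    | C a =>
      have h0 : subst φ (0 : MvPowerSeries ι ℂ) = (0 : MvPowerSeries ι ℂ) := by
        rw [← coe_substAlgHom hs, map_zero]
      simp [h0]
    | add p q hp hq =>
      simp only [MvPolynomial.coe_add, map_add, hp, hq, add_mul, Finset.sum_add_distrib]
    | mul_X p k hp =>
      simp only [MvPolynomial.coe_mul, MvPolynomial.coe_X, Derivation.leibniz, smul_eq_mul,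
        substLinear_apply, subst_mul hs, subst_add hs, subst_X hs] at hp ⊢
      rw [hp]
      simp only [add_mul, Finset.sum_add_distrib]
      congr 1
      · rw [Finset.sum_eq_single k]
        · rw [pderiv_X_self, ← coe_substAlgHom hs, map_one, mul_one]
        · intro j _ hj
          rw [pderiv_X_of_ne hj.symm, ← coe_substAlgHom hs, map_zero, mul_zero, zero_mul]
        · simp
      · rw [Finset.mul_sum]
        exact Finset.sum_congr rfl fun j _ => by ring
  have hφ1 : ∀ j, φ j ∈ weightFiltration (fun _ : ι => 1) 1 := by
    intro j d hd
    have : d = 0 := by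
      rw [← Finsupp.degree_eq_zero_iff, Finsupp.degree_eq_weight_one]
      exact Nat.lt_one_iff.mp hd
    subst this
    exact congrFun hφ j
  have hrem : ∀ s (g : MvPowerSeries ι ℂ), g ∈ weightFiltration (fun _ : ι => 1) (s + 1) →
      pderiv ℂ i (subst φ g : MvPowerSeries ι ℂ) - ∑ j, subst φ (pderiv ℂ j g) * pderiv ℂ i (φ j) ∈
        weightFiltration (fun _ : ι => 1) s := by
    intro s g hg
    refine Submodule.sub_mem _
      (pderiv_mem_weightFiltration i (subst_mem_weightFiltration hs hφ1 hg))
      (Submodule.sum_mem _ fun j _ => mul_mem_weightFiltration_left _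
        (subst_mem_weightFiltration hs hφ1 (pderiv_mem_weightFiltration j hg)))
  rw [← sub_eq_zero]
  refine eq_zero_of_forall_mem_gradeFiltration (c := coeffEquiv ι)
    (gr := Finsupp.weight fun _ : ι => 1) fun s => ?_
  -- The identity holds for polynomials. Truncating one degree beyond `s` compensates for the degree
  -- lost by differentiation.
  let p : MvPolynomial ι ℂ := truncTotal (s + 1) f
  have hfp : f - p ∈ weightFiltration (fun _ : ι => 1) (s + 1) := by
    intro d hd
    have hd' : d.degree < s + 1 := by rw [Finsupp.degree_eq_weight_one]; exact hd
    rw [coeffEquiv_apply, map_sub, MvPolynomial.coeff_coe, coeff_truncTotal _ hd', sub_self]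
  have h1 := hrem s _ hfp
  have h2 := hpoly p
  simp only [← substLinear_apply hs, map_sub, sub_mul, Finset.sum_sub_distrib] at h1 h2 ⊢
  rw [h2] at h1
  convert h1 using 1
  abel

theorem derivation_subst {φ : FormalVF ι} (hφ : constPart φ = 0) (A : FormalVF ι)
    (f : MvPowerSeries ι ℂ) :
    derivation A (subst φ f) = ∑ j, subst φ (pderiv ℂ j f) * star φ A j := by
  simp only [derivation_apply, pderiv_subst hφ, star, Finset.mul_sum]
  rw [Finset.sum_comm]
  exact Finset.sum_congr rfl fun i _ => Finset.sum_congr rfl fun j _ => by ring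

/-- By the chain rule, substitution of `φ` intertwines the derivations of `B` and `A`.
Transformation of vector fields thereby becomes conjugation of operators on power series. -/
theorem Transforms.derivation_subst {φ A B : FormalVF ι} (h : Transforms φ A B)
    (hφ : constPart φ = 0) (f : MvPowerSeries ι ℂ) :
    derivation A (subst φ f) = subst φ (derivation B f) := by
  have hs := hasSubst_of_constPart hφ
  rw [FormalVF.derivation_subst hφ, h, derivation_apply, ← coe_substAlgHom hs, map_sum]
  refine Finset.sum_congr rfl fun j _ => ?_
  rw [map_mul, mul_comm, coe_substAlgHom hs]
  rfl

/-- A nonlinear representation can be transported along an invertible formal map. -/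
theorem exists_isEquivalence [DecidableEq ι] {g : Type*} [LieRing g] [LieAlgebra ℂ g]
    {T : g →ₗ[ℂ] FormalVF ι} (hT : IsNonlinearRep T) {φ : FormalVF ι} (hφ : IsFormalChange φ)
    (hbij : Function.Bijective (subst φ : MvPowerSeries ι ℂ → MvPowerSeries ι ℂ)) :
    ∃ T' : g →ₗ[ℂ] FormalVF ι, IsEquivalence φ T T' := by
  have hs := hasSubst_of_constPart hφ.1
  let e : MvPowerSeries ι ℂ ≃ₗ[ℂ] MvPowerSeries ι ℂ := LinearEquiv.ofBijective (substLinear hs)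
    (by convert hbij using 1; ext1 f; exact substLinear_apply hs f)
  have he : ∀ f, e f = subst φ f := fun f => substLinear_apply hs f
  let T' : g →ₗ[ℂ] FormalVF ι :=
    { toFun := fun X j => e.symm (star φ (T X) j)
      map_add' := fun X Y => by
        ext1 j
        simp [star_apply, derivation_add]
      map_smul' := fun a X => by
        ext1 j
        simp [star_apply, derivation_smul] }
  have htr : ∀ X, Transforms φ (T X) (T' X) := by
    intro X
    ext1 j
    change _ = subst φ (e.symm (star φ (T X) j))
    rw [← he, e.apply_symm_apply]
  refine ⟨T', hφ, fun X Y => ?_, htr⟩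
  ext1 j
  -- After substituting `φ`, both sides of the bracket identity become iterated derivatives of `φ j`
  -- along the original fields.
  apply hbij.1
  have h1 : subst φ (T' ⁅X, Y⁆ j) = derivation (T ⁅X, Y⁆) (φ j) := by
    rw [← star_apply, htr]
    rfl
  have h2 : φ j = subst φ (MvPowerSeries.X j : MvPowerSeries ι ℂ) := (subst_X hs j).symm
  rw [h1, hT, derivation_bracket, h2, (htr Y).derivation_subst hφ.1, (htr X).derivation_subst hφ.1,
    (htr X).derivation_subst hφ.1, (htr Y).derivation_subst hφ.1, ← subst_sub hs,
    ← derivation_bracket, derivation_X]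

end PowerSeries

end FormalVF

/-! ### Linear parts of formal maps and vector fields. -/

namespace FormalVF

open MvPowerSeries

section LinearPart

variable {ι : Type*} [Fintype ι]

/-- The matrix of the linear part of a formal map. -/
noncomputable def linearPart (A : FormalVF ι) : Matrix ι ι ℂ :=
  Matrix.of fun i j => coeff (Finsupp.single j 1) (A i)

omit [Fintype ι] in
theorem linearPart_apply (A : FormalVF ι) (i j : ι) :
    linearPart A i j = coeff (Finsupp.single j 1) (A i) := rfl

omit [Fintype ι] in
theorem coeff_single_eq (j : ι) (f : MvPowerSeries ι ℂ) :
    coeff (Finsupp.single j 1) f = constantCoeff (pderiv ℂ j f) := by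
  rw [← coeff_zero_eq_constantCoeff_apply, coeff_pderiv]
  simp

theorem constantCoeff_subst_eq {φ : FormalVF ι} (hφ : constPart φ = 0) (f : MvPowerSeries ι ℂ) :
    constantCoeff (subst φ f : MvPowerSeries ι ℂ) = constantCoeff f := by
  have hs := hasSubst_of_constPart hφ
  have h1 : f = (f - C (constantCoeff f)) + C (constantCoeff f) := by ring
  have h2 : constantCoeff (subst φ (f - C (constantCoeff f)) : MvPowerSeries ι ℂ) = 0 :=
    constantCoeff_subst_eq_zero hs (fun i => congrFun hφ i) (by simp)
  conv_lhs => rw [h1]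
  rw [subst_add hs, map_add, h2, subst_C, zero_add, constantCoeff_C]

theorem coeff_single_subst {φ : FormalVF ι} (hφ : constPart φ = 0) (k : ι)
    (f : MvPowerSeries ι ℂ) :
    coeff (Finsupp.single k 1) (subst φ f : MvPowerSeries ι ℂ) =
      ∑ j, coeff (Finsupp.single j 1) f * linearPart φ j k := by
  simp only [linearPart_apply, coeff_single_eq, pderiv_subst hφ, map_sum, map_mul,
    constantCoeff_subst_eq hφ]

theorem coeff_single_derivation {A : FormalVF ι} (hA : constPart A = 0) (k : ι)
    (f : MvPowerSeries ι ℂ) :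
    coeff (Finsupp.single k 1) (derivation A f) =
      ∑ j, coeff (Finsupp.single j 1) f * linearPart A j k := by
  have hA' : ∀ i, constantCoeff (A i) = 0 := fun i => congrFun hA i
  simp only [linearPart_apply, coeff_single_eq, derivation_apply, map_sum, map_mul,
    Derivation.leibniz, smul_eq_mul, map_add, hA', zero_mul, zero_add]

theorem constantCoeff_derivation {A : FormalVF ι} (hA : constPart A = 0)
    (f : MvPowerSeries ι ℂ) : constantCoeff (derivation A f) = 0 := by
  have hA' : ∀ i, constantCoeff (A i) = 0 := fun i => congrFun hA i
  simp [derivation_apply, hA']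

/-- The sign is opposite to the matrix commutator: linear parts represent the Lie algebra on linear
forms, that is, on row vectors. -/
theorem linearPart_bracket {A B : FormalVF ι} (hA : constPart A = 0) (hB : constPart B = 0) :
    linearPart (bracket A B) = linearPart B * linearPart A - linearPart A * linearPart B := by
  ext i k
  rw [linearPart_apply, bracket, Pi.sub_apply, map_sub, star_apply, star_apply,
    coeff_single_derivation hA, coeff_single_derivation hB]
  rfl

theorem star_coordField [DecidableEq ι] (φ : FormalVF ι) (i j : ι) :
    star φ (coordField i) j = pderiv ℂ i (φ j) := by
  rw [star_apply, derivation_apply, Finset.sum_eq_single i]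
  · simp [coordField]
  · intro k _ hk
    simp [coordField, hk]
  · simp

omit [Fintype ι] in
theorem eq_zero_or_single_of_degree_lt_two {d : ι →₀ ℕ} (hd : d.degree < 2) :
    d = 0 ∨ ∃ j, d = Finsupp.single j 1 := by
  by_cases h0 : d.degree = 0
  · exact Or.inl ((Finsupp.degree_eq_zero_iff d).mp h0)
  · refine Or.inr ?_
    have h1 : d.degree = 1 := by omega
    have := Finsupp.range_single_one (σ := ι)
    have h2 : d ∈ Set.range fun a : ι => Finsupp.single a 1 := by
      rw [this]; exact h1
    obtain ⟨j, hj⟩ := h2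
    exact ⟨j, hj.symm⟩

theorem mem_weightFiltration_one_two {f : MvPowerSeries ι ℂ} (h0 : constantCoeff f = 0)
    (h1 : ∀ j, coeff (Finsupp.single j 1) f = 0) :
    f ∈ weightFiltration (fun _ : ι => 1) 2 := by
  intro d hd
  rcases eq_zero_or_single_of_degree_lt_two
    (show d.degree < 2 by rw [Finsupp.degree_eq_weight_one]; exact hd) with rfl | ⟨j, rfl⟩
  · exact h0
  · exact h1 j

end LinearPart

/-! ### Constant x-fields, maps that shift by functions of `y`, and infinite compositions. -/

section Split

variable {p q : ℕ}

/-- The constant vector field `∑ i, a i ∂/∂x_i`. -/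
noncomputable def xField (q : ℕ) (a : Fin p → ℂ) : FormalVF (Fin p ⊕ Fin q) :=
  Sum.elim (fun i => C (a i)) fun _ => 0

@[simp] theorem xField_inl (a : Fin p → ℂ) (i : Fin p) : xField q a (Sum.inl i) = C (a i) := rfl

@[simp] theorem xField_inr (a : Fin p → ℂ) (j : Fin q) : xField q a (Sum.inr j) = 0 := rfl

theorem sum_smul_coordField (a : Fin p → ℂ) :
    ∑ i, a i • coordField (ι := Fin p ⊕ Fin q) (Sum.inl i) = xField q a := by
  ext1 k
  rw [Finset.sum_apply]
  rcases k with k | k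
  · rw [Finset.sum_eq_single k]
    · simp [coordField, smul_eq_C_mul]
    · intro i _ hi
      simp [coordField, hi.symm]
    · simp
  · simp [coordField]

theorem coordField_inl (i : Fin p) :
    coordField (ι := Fin p ⊕ Fin q) (Sum.inl i) = xField q (Pi.single i 1) := by
  rw [← sum_smul_coordField, Finset.sum_eq_single i]
  · simp
  · intro j _ hj
    simp [hj]
  · simp

theorem star_xField (φ : FormalVF (Fin p ⊕ Fin q)) (a : Fin p → ℂ) (j : Fin p ⊕ Fin q) :
    star φ (xField q a) j = ∑ i, a i • pderiv ℂ (Sum.inl i) (φ j) := by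
  rw [star_apply, derivation_apply, Fintype.sum_sum_type]
  simp [smul_eq_C_mul]

theorem comp_xField {φ : FormalVF (Fin p ⊕ Fin q)} (hφ : HasSubst φ) (a : Fin p → ℂ) :
    comp (xField q a) φ = xField q a := by
  ext1 k
  rcases k with k | k
  · simp [comp, subst_C]
  · change subst φ (0 : MvPowerSeries (Fin p ⊕ Fin q) ℂ) = 0
    rw [← coe_substAlgHom hφ, map_zero]

/-- A power series depends only on `y` if and only if its derivatives along `x` vanish. -/
theorem forall_pderiv_inl_eq_zero_iff {f : MvPowerSeries (Fin p ⊕ Fin q) ℂ} :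
    (∀ i, pderiv ℂ (Sum.inl i) f = 0) ↔ ∀ d, coeff d f ≠ 0 → YOnly d := by
  constructor
  · intro h d hd i
    by_contra hi
    have hd' : d - Finsupp.single (Sum.inl i) 1 + Finsupp.single (Sum.inl i) 1 = d :=
      tsub_add_cancel_of_le (Finsupp.single_le_iff.mpr (Nat.one_le_iff_ne_zero.mpr hi))
    have h1 := congrArg (coeff (d - Finsupp.single (Sum.inl i) 1)) (h i)
    rw [coeff_pderiv, hd', coeff_zero] at h1
    exact (mul_ne_zero hd (Nat.cast_add_one_ne_zero _)) h1
  · intro h i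
    ext d
    rw [coeff_pderiv, coeff_zero]
    by_contra hne
    have := h _ (left_ne_zero_of_mul hne) i
    simp at this

/-- `φ - I` depends only on `y`. -/
def IsYShift (φ : FormalVF (Fin p ⊕ Fin q)) : Prop :=
  ∀ i j, pderiv ℂ (Sum.inl i) (φ j) = pderiv ℂ (Sum.inl i) (X j)

theorem isYShift_idMap : IsYShift (idMap (Fin p ⊕ Fin q)) := fun _ _ => rfl

theorem IsYShift.pderiv_subst_eq_zero {φ : FormalVF (Fin p ⊕ Fin q)} (h : IsYShift φ)
    (hφ : constPart φ = 0) {f : MvPowerSeries (Fin p ⊕ Fin q) ℂ}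
    (hf : ∀ i, pderiv ℂ (Sum.inl i) f = 0) (i : Fin p) :
    pderiv ℂ (Sum.inl i) (subst φ f : MvPowerSeries (Fin p ⊕ Fin q) ℂ) = 0 := by
  have hs := hasSubst_of_constPart hφ
  rw [pderiv_subst hφ]
  refine Finset.sum_eq_zero fun j _ => ?_
  rw [h]
  by_cases hj : j = Sum.inl i
  · subst hj
    rw [hf, ← coe_substAlgHom hs, map_zero, zero_mul]
  · rw [pderiv_X_of_ne hj, mul_zero]

/-- Differentiation along a constant x-field sees only the x-derivatives of `φ`, and these agree
with those of the identity. -/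
theorem IsYShift.star_xField {φ : FormalVF (Fin p ⊕ Fin q)} (h : IsYShift φ) (a : Fin p → ℂ) :
    star φ (xField q a) = xField q a := by
  have h1 : star φ (xField q a) = star (idMap _) (xField q a) := by
    ext1 j
    rw [FormalVF.star_xField, FormalVF.star_xField]
    exact Finset.sum_congr rfl fun i _ => by rw [h i j]; rfl
  rw [h1]
  ext1 j
  rw [star_apply]
  exact derivation_X _ _

theorem IsYShift.transforms_xField {φ : FormalVF (Fin p ⊕ Fin q)} (h : IsYShift φ)
    (hφ : constPart φ = 0) (a : Fin p → ℂ) : Transforms φ (xField q a) (xField q a) := by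
  rw [Transforms, h.star_xField, comp_xField (hasSubst_of_constPart hφ)]

theorem constPart_idMap {ι : Type*} : constPart (idMap ι) = 0 := by
  ext i
  simp [constPart, idMap]

theorem comp_idMap_add {ι : Type*} {φ : FormalVF ι} (hφ : HasSubst φ) (W : FormalVF ι) (i : ι) :
    comp (idMap ι + W) φ i = φ i + subst φ (W i) := by
  simp [comp, idMap, subst_add hφ, subst_X hφ]

theorem constPart_partialComp_and_isYShift {W : ℕ → FormalVF (Fin p ⊕ Fin q)}
    (hW : ∀ k, 1 ≤ k → IsHomogeneous k (W k) ∧ DependsOnlyOnY (W k)) (k : ℕ) :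
    constPart (partialComp W k) = 0 ∧ IsYShift (partialComp W k) := by
  induction k with
  | zero => exact ⟨constPart_idMap, isYShift_idMap⟩
  | succ k ih =>
    obtain ⟨h0, h1⟩ := ih
    obtain ⟨hh, hy⟩ := hW (k + 1) (by omega)
    have hs := hasSubst_of_constPart h0
    constructor
    · ext i
      have : constantCoeff (W (k + 1) i) = 0 := by
        by_contra hne
        have := hh i 0 hne
        simp at this
      rw [partialComp, constPart, comp_idMap_add hs, map_add, constantCoeff_subst_eq h0, this,
        add_zero]
      exact congrFun h0 i
    · intro i j
      rw [partialComp, comp_idMap_add hs, map_add, h1,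
        h1.pderiv_subst_eq_zero h0 (forall_pderiv_inl_eq_zero_iff.mpr (hy j)), add_zero]

theorem IsInfiniteComp.constPart_eq_zero_and_isYShift {W : ℕ → FormalVF (Fin p ⊕ Fin q)}
    {φ : FormalVF (Fin p ⊕ Fin q)} (hφ : IsInfiniteComp W φ)
    (hW : ∀ k, 1 ≤ k → IsHomogeneous k (W k) ∧ DependsOnlyOnY (W k)) :
    constPart φ = 0 ∧ IsYShift φ := by
  constructor
  · ext i
    obtain ⟨k, hk⟩ := (hφ i 0).exists
    rw [constPart, ← coeff_zero_eq_constantCoeff_apply, ← hk]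
    exact congrFun (constPart_partialComp_and_isYShift hW k).1 i
  · intro i j
    ext d
    obtain ⟨k, hk⟩ := (hφ j (d + Finsupp.single (Sum.inl i) 1)).exists
    rw [coeff_pderiv, ← hk, ← coeff_pderiv, (constPart_partialComp_and_isYShift hW k).2]

/-- The homogeneous part of degree `k` of a formal map. -/
noncomputable def homogeneousPart {ι : Type*} (k : ℕ) (A : FormalVF ι) : FormalVF ι :=
  fun i d => if d.degree = k then coeff d (A i) else 0

theorem coeff_homogeneousPart {ι : Type*} (k : ℕ) (A : FormalVF ι) (i : ι) (d : ι →₀ ℕ) :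
    coeff d (homogeneousPart k A i) = if d.degree = k then coeff d (A i) else 0 := rfl

/-- The sequence of finite compositions approximating `φ`. -/
noncomputable def approxComp {ι : Type*} (φ : FormalVF ι) : ℕ → FormalVF ι
  | 0 => idMap ι
  | k + 1 => comp (idMap ι + homogeneousPart (k + 1) (φ - approxComp φ k)) (approxComp φ k)

/-- The correction `W` is the lowest possibly nonzero part of the error and depends only on `y`. As
the y-components of the composition built so far are the identity modulo degree 2, substituting it
into `W` alters only higher degrees, and the error gains one degree. -/
theorem approxComp_properties {φ : FormalVF (Fin p ⊕ Fin q)} (hφ : constPart φ = 0)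
    (hshift : IsYShift φ)
    (hy : ∀ j, φ (Sum.inr j) - X (Sum.inr j) ∈ weightFiltration (fun _ => 1) 2) (k : ℕ) :
    constPart (approxComp φ k) = 0 ∧ IsYShift (approxComp φ k) ∧
    (∀ j, approxComp φ k (Sum.inr j) - X (Sum.inr j) ∈ weightFiltration (fun _ => 1) 2) ∧
    ∀ i, φ i - approxComp φ k i ∈ weightFiltration (fun _ => 1) (k + 1) := by
  induction k with
  | zero =>
    refine ⟨constPart_idMap, isYShift_idMap, fun j => ?_, fun i d hd => ?_⟩
    · simp [approxComp, idMap]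
    · have : d = 0 := by
        rw [← Finsupp.degree_eq_zero_iff, Finsupp.degree_eq_weight_one]
        exact Nat.lt_one_iff.mp hd
      subst this
      have h0 : constantCoeff (φ i) = 0 := congrFun hφ i
      simp [approxComp, idMap, h0]
  | succ k ih =>
    obtain ⟨h0, h1, h2, h3⟩ := ih
    set Φ := approxComp φ k with hΦ
    have hs := hasSubst_of_constPart h0
    set W := homogeneousPart (k + 1) (φ - Φ) with hW
    have hstep : ∀ i, approxComp φ (k + 1) i = Φ i + subst Φ (W i) := fun i => by
      rw [approxComp, ← hΦ, ← hW, comp_idMap_add hs]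
    have hdeg : ∀ d : Fin p ⊕ Fin q →₀ ℕ, d.degree = Finsupp.weight (fun _ => 1) d := fun d => by
      rw [Finsupp.degree_eq_weight_one]
    have hΦ1 : ∀ j, Φ j ∈ weightFiltration (fun _ => 1) 1 := by
      intro j d hd
      have : d = 0 := by
        rw [← Finsupp.degree_eq_zero_iff, hdeg]
        exact Nat.lt_one_iff.mp hd
      subst this
      exact congrFun h0 j
    have hWmem : ∀ i, W i ∈ weightFiltration (fun _ => 1) (k + 1) := by
      intro i d hd
      rw [coeffEquiv_apply, hW, coeff_homogeneousPart, if_neg (by rw [hdeg]; omega)]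
    have hWy : ∀ j, W (Sum.inr j) ∈ weightFiltration (fun _ => 1) 2 := by
      intro j d hd
      rw [coeffEquiv_apply, hW, coeff_homogeneousPart]
      have := Submodule.sub_mem _ (hy j) (h2 j) d hd
      rw [sub_sub_sub_cancel_right] at this
      split_ifs
      · exact this
      · rfl
    have hdiff : ∀ i j, pderiv ℂ (Sum.inl i) ((φ - Φ) j) = 0 := by
      intro i j
      rw [Pi.sub_apply, map_sub, hshift, h1, sub_self]
    have hWdep : ∀ j d, coeff d (W j) ≠ 0 → YOnly d := by
      intro j d hd
      rw [hW, coeff_homogeneousPart] at hd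
      refine (forall_pderiv_inl_eq_zero_iff.mp fun i => hdiff i j) d ?_
      intro h
      rw [h, ite_self] at hd
      exact hd rfl
    refine ⟨?_, ?_, ?_, ?_⟩
    · ext i
      have h4 : constantCoeff (W i) = 0 := hWmem i 0 (by simp)
      have h5 : constantCoeff (Φ i) = 0 := congrFun h0 i
      rw [constPart, hstep, map_add, constantCoeff_subst_eq h0, h4, h5]
      simp
    · intro i j
      rw [hstep, map_add, h1, h1.pderiv_subst_eq_zero h0
        (forall_pderiv_inl_eq_zero_iff.mpr (hWdep j)), add_zero]
    · intro j
      rw [hstep, add_sub_right_comm]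
      exact Submodule.add_mem _ (h2 j) (subst_mem_weightFiltration hs hΦ1 (hWy j))
    · intro i d hd
      have hsub : coeff d (subst Φ (W i) : MvPowerSeries (Fin p ⊕ Fin q) ℂ) = coeff d (W i) := by
        refine coeff_subst_eq_coeff hs (hWmem i) (fun e he j hj => ?_) (by omega)
        have hyo := hWdep i e he
        rcases j with j | j
        · exact absurd (hyo j) (Finsupp.mem_support_iff.mp hj)
        · exact h2 j
      rw [coeffEquiv_apply, hstep, map_sub, map_add, hsub, hW, coeff_homogeneousPart,
        Pi.sub_apply, map_sub]
      split_ifs with hdk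
      · ring
      · have := h3 i d (by rw [hdeg] at hdk; omega)
        rw [coeffEquiv_apply, map_sub] at this
        linear_combination this

/-- A formal map `I + V`, with `V` depending only on `y`, is an infinite composition of maps
`I + W_k`. -/
theorem exists_isInfiniteComp {φ : FormalVF (Fin p ⊕ Fin q)} (hφ : constPart φ = 0)
    (hshift : IsYShift φ)
    (hy : ∀ j, φ (Sum.inr j) - X (Sum.inr j) ∈ weightFiltration (fun _ => 1) 2) :
    ∃ W : ℕ → FormalVF (Fin p ⊕ Fin q),
      (∀ k, 1 ≤ k → IsHomogeneous k (W k) ∧ DependsOnlyOnY (W k)) ∧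
      (∀ j : Fin q, W 1 (Sum.inr j) = 0) ∧ IsInfiniteComp W φ := by
  have hprop := approxComp_properties hφ hshift hy
  -- The factor of degree `k` corrects the composition of the first `k - 1` factors; the value at `k
  -- = 0` never enters a composition.
  let W : ℕ → FormalVF (Fin p ⊕ Fin q) := fun k => homogeneousPart k (φ - approxComp φ (k - 1))
  have hpart : ∀ k, partialComp W k = approxComp φ k := by
    intro k
    induction k with
    | zero => rfl
    | succ k ih => rw [partialComp, ih, approxComp]; rfl
  refine ⟨W, fun k _ => ⟨fun i d hd => ?_, fun i d hd => ?_⟩, fun j => ?_, fun i d => ?_⟩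
  · by_contra hne
    simp only [W] at hd
    rw [coeff_homogeneousPart, if_neg hne] at hd
    exact hd rfl
  · simp only [W] at hd
    rw [coeff_homogeneousPart] at hd
    refine (forall_pderiv_inl_eq_zero_iff.mp fun l => ?_) d
      (fun h => by rw [h, ite_self] at hd; exact hd rfl)
    rw [Pi.sub_apply, map_sub, hshift, (hprop (k - 1)).2.1, sub_self]
  · ext d
    simp only [W]
    rw [coeff_homogeneousPart, coeff_zero]
    split_ifs with hd
    · refine hy j d ?_
      rw [Finsupp.degree_eq_weight_one] at hd
      exact lt_of_eq_of_lt hd one_lt_two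
    · rfl
  · filter_upwards [Filter.eventually_ge_atTop d.degree] with k hk
    have := (hprop k).2.2.2 i d (by
      rw [Finsupp.degree_eq_weight_one] at hk
      exact Nat.lt_succ_of_le hk)
    rw [hpart]
    rw [coeffEquiv_apply, map_sub, sub_eq_zero] at this
    exact this.symm

/-- `T` maps `m` onto the constant vector fields in the `x`-directions. -/
def MapsOntoXFields {g : Type*} [LieRing g] [LieAlgebra ℂ g] (m : LieIdeal ℂ g)
    (T : g →ₗ[ℂ] FormalVF (Fin p ⊕ Fin q)) : Prop :=
  (∀ X ∈ m, ∃ a, T X = xField q a) ∧ ∀ a, ∃ X ∈ m, T X = xField q a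

/-! ### Consequences of `m` being an ideal. -/

section Shape

variable {g : Type*} [LieRing g] [LieAlgebra ℂ g] {m : LieIdeal ℂ g}
  {T : g →ₗ[ℂ] FormalVF (Fin p ⊕ Fin q)}

/-- Choose `Y ∈ m` with `T_Y = ∂/∂x_i`. Then `∂_i T_X` is the bracket of `T_Y` and `T_X`, hence `T`
at `⁅Y, X⁆`, which lies in `m`. -/
theorem MapsOntoXFields.exists_pderiv_eq (hm : MapsOntoXFields m T) (hT : IsNonlinearRep T)
    (X : g) (i : Fin p) : ∃ a, ∀ j, pderiv ℂ (Sum.inl i) (T X j) = xField q a j := by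
  obtain ⟨Y, hY, hTY⟩ := hm.2 (Pi.single i 1)
  obtain ⟨a, ha⟩ := hm.1 ⁅Y, X⁆ (lie_mem_left ℂ g m Y X hY)
  refine ⟨a, fun j => ?_⟩
  rw [← ha, hT, bracket, hTY, ← coordField_inl, Pi.sub_apply, star_coordField, star_apply]
  have : derivation (T X) (coordField (Sum.inl i) j) = 0 := by
    rw [coordField, Pi.single_apply]
    split_ifs
    · exact Derivation.map_one_eq_zero _
    · exact map_zero _
  rw [this, sub_zero]

theorem MapsOntoXFields.pderiv_inl_inr (hm : MapsOntoXFields m T) (hT : IsNonlinearRep T)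
    (X : g) (i : Fin p) (j : Fin q) : pderiv ℂ (Sum.inl i) (T X (Sum.inr j)) = 0 := by
  obtain ⟨a, ha⟩ := hm.exists_pderiv_eq hT X i
  exact ha _

theorem MapsOntoXFields.pderiv_inl_inl (hm : MapsOntoXFields m T) (hT : IsNonlinearRep T)
    (X : g) (i j : Fin p) : pderiv ℂ (Sum.inl i) (T X (Sum.inl j)) =
      C (linearPart (T X) (Sum.inl j) (Sum.inl i)) := by
  obtain ⟨a, ha⟩ := hm.exists_pderiv_eq hT X i
  rw [linearPart_apply, coeff_single_eq, ha]
  simp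

theorem MapsOntoXFields.linearPart_inr_inl (hm : MapsOntoXFields m T) (hT : IsNonlinearRep T)
    (X : g) (i : Fin p) (j : Fin q) : linearPart (T X) (Sum.inr j) (Sum.inl i) = 0 := by
  rw [linearPart_apply, coeff_single_eq, hm.pderiv_inl_inr hT, map_zero]

theorem MapsOntoXFields.y_shape (hm : MapsOntoXFields m T) (hT : IsNonlinearRep T) (X : g)
    (j : Fin q) (d : Fin p ⊕ Fin q →₀ ℕ) (hd : coeff d (T X (Sum.inr j)) ≠ 0) : YOnly d :=
  forall_pderiv_inl_eq_zero_iff.mp (fun i => hm.pderiv_inl_inr hT X i j) d hd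

theorem MapsOntoXFields.x_shape (hm : MapsOntoXFields m T) (hT : IsNonlinearRep T) (X : g)
    (i : Fin p) (d : Fin p ⊕ Fin q →₀ ℕ) (hd : coeff d (T X (Sum.inl i)) ≠ 0) :
    (∃ j, d = Finsupp.single (Sum.inl j) 1) ∨ YOnly d := by
  classical
  by_contra! h
  obtain ⟨h1, h2⟩ := h
  simp only [YOnly, not_forall] at h2
  obtain ⟨k, hk⟩ := h2
  have hd' : d - Finsupp.single (Sum.inl k) 1 + Finsupp.single (Sum.inl k) 1 = d :=
    tsub_add_cancel_of_le (Finsupp.single_le_iff.mpr (Nat.one_le_iff_ne_zero.mpr hk))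
  have h3 := congrArg (coeff (d - Finsupp.single (Sum.inl k) 1)) (hm.pderiv_inl_inl hT X k i)
  rw [coeff_pderiv, hd', coeff_C, if_neg] at h3
  · exact mul_ne_zero hd (Nat.cast_add_one_ne_zero _) h3
  · intro h0
    rw [h0, zero_add] at hd'
    exact h1 k hd'.symm

end Shape

/-! ### Linear changes of coordinates. -/

section LinearChange

variable {P P' : Matrix (Fin p) (Fin p) ℂ} {Q Q' : Matrix (Fin q) (Fin q) ℂ}

theorem constPart_linearChange (P : Matrix (Fin p) (Fin p) ℂ) (Q : Matrix (Fin q) (Fin q) ℂ) :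
    constPart (linearChange P Q) = 0 := by
  ext i
  rcases i with i | i <;> simp [constPart, linearChange]

theorem linearPart_linearChange (P : Matrix (Fin p) (Fin p) ℂ) (Q : Matrix (Fin q) (Fin q) ℂ) :
    linearPart (linearChange P Q) = Matrix.fromBlocks P 0 0 Q := by
  ext i j
  rcases i with i | i <;> rcases j with j | j <;>
    simp [linearPart_apply, linearChange, coeff_X, Finsupp.single_left_inj]

theorem isFormalChange_linearChange (hP : IsUnit P.det) (hQ : IsUnit Q.det) :
    IsFormalChange (linearChange P Q) := by
  refine ⟨constPart_linearChange P Q, ?_⟩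
  change IsUnit (linearPart (linearChange P Q)).det
  rw [linearPart_linearChange, Matrix.det_fromBlocks_zero₂₁]
  exact hP.mul hQ

theorem subst_linearChange_linearChange (i : Fin p ⊕ Fin q) :
    subst (linearChange P' Q') (linearChange P Q i) = linearChange (P * P') (Q * Q') i := by
  have hs := hasSubst_of_constPart (constPart_linearChange P' Q')
  rcases i with i | i
  · simp only [linearChange, Sum.elim_inl] at hs ⊢
    rw [← substLinear_apply hs, map_sum]
    simp only [map_smul, substLinear_apply, subst_X hs, Sum.elim_inl, Finset.smul_sum, smul_smul,
      Matrix.mul_apply, Finset.sum_smul]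
    rw [Finset.sum_comm]
  · simp only [linearChange, Sum.elim_inr] at hs ⊢
    rw [← substLinear_apply hs, map_sum]
    simp only [map_smul, substLinear_apply, subst_X hs, Sum.elim_inr, Finset.smul_sum, smul_smul,
      Matrix.mul_apply, Finset.sum_smul]
    rw [Finset.sum_comm]

theorem linearChange_one : linearChange (1 : Matrix (Fin p) (Fin p) ℂ)
    (1 : Matrix (Fin q) (Fin q) ℂ) = X := by
  ext1 i
  rcases i with i | i <;>
    simp [linearChange, Matrix.one_apply, ite_smul]

theorem bijective_subst_linearChange (hP : IsUnit P.det) (hQ : IsUnit Q.det) :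
    Function.Bijective (subst (linearChange P Q) : MvPowerSeries (Fin p ⊕ Fin q) ℂ →
      MvPowerSeries (Fin p ⊕ Fin q) ℂ) := by
  have hs := hasSubst_of_constPart (constPart_linearChange P Q)
  have hs' := hasSubst_of_constPart (constPart_linearChange P⁻¹ Q⁻¹)
  refine Function.bijective_iff_has_inverse.mpr ⟨subst (linearChange P⁻¹ Q⁻¹), fun f => ?_,
    fun f => ?_⟩
  · rw [subst_comp_subst_apply hs hs']
    simp only [subst_linearChange_linearChange]
    rw [Matrix.mul_nonsing_inv _ hP, Matrix.mul_nonsing_inv _ hQ]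
    change subst (linearChange (1 : Matrix (Fin p) (Fin p) ℂ) (1 : Matrix (Fin q) (Fin q) ℂ)) f = f
    rw [linearChange_one, subst_self]
    rfl
  · rw [subst_comp_subst_apply hs' hs]
    simp only [subst_linearChange_linearChange]
    rw [Matrix.nonsing_inv_mul _ hP, Matrix.nonsing_inv_mul _ hQ]
    change subst (linearChange (1 : Matrix (Fin p) (Fin p) ℂ) (1 : Matrix (Fin q) (Fin q) ℂ)) f = f
    rw [linearChange_one, subst_self]
    rfl

theorem star_linearChange_xField (a : Fin p → ℂ) :
    star (linearChange P Q) (xField q a) = xField q (P.mulVec a) := by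
  classical
  ext1 k
  rw [star_xField]
  rcases k with k | k
  · simp only [linearChange, Sum.elim_inl, map_sum, Derivation.map_smul, pderiv_X, xField_inl,
      Matrix.mulVec, dotProduct]
    refine Finset.sum_congr rfl fun i _ => ?_
    rw [Finset.sum_eq_single i]
    · simp [smul_eq_C_mul, mul_comm]
    · intro j _ hj
      simp [hj]
    · simp
  · simp [linearChange]

theorem Transforms.eq_xField {φ A : FormalVF (Fin p ⊕ Fin q)} {a b : Fin p → ℂ}
    (h : Transforms φ (xField q a) A) (hs : HasSubst φ)
    (hinj : Function.Injective (subst φ : MvPowerSeries (Fin p ⊕ Fin q) ℂ →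
      MvPowerSeries (Fin p ⊕ Fin q) ℂ)) (hstar : star φ (xField q a) = xField q b) :
    A = xField q b := by
  rw [Transforms, hstar, ← comp_xField hs] at h
  ext1 j
  exact (hinj (congrFun h j)).symm

end LinearChange

end Split

end FormalVF

/-! ### Poincaré–Dulac normalization of a single vector field. -/

namespace FormalVF

open MvPowerSeries

/-- Matrices that represent a solvable Lie algebra on row vectors can be conjugated simultaneously
to upper triangular form, compatibly with the generalized eigenspaces of any given element. -/
theorem exists_triangular_conjugates {r : Type*} [LieRing r] [LieAlgebra ℂ r]
    [LieAlgebra.IsSolvable r] {n : ℕ} (M : r →ₗ[ℂ] Matrix (Fin n) (Fin n) ℂ)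
    (hM : ∀ X Y, M ⁅X, Y⁆ = M Y * M X - M X * M Y) :
    -- The weights precede `H` in the quantifiers, because `H` will be chosen generic with respect
    -- to them.
    ∃ χ : Fin n → Module.Dual ℂ r, ∀ H, ∃ (P : Matrix (Fin n) (Fin n) ℂ)
      (N : r → Matrix (Fin n) (Fin n) ℂ), IsUnit P.det ∧ (∀ X, N X * P = P * M X) ∧
      (∀ X i j, j < i → N X i j = 0) ∧ (∀ X i, N X i i = χ i X) ∧
      ∀ i j, N H i j ≠ 0 → χ j H = χ i H := by
  let ρ : r →ₗ[ℂ] Module.End ℂ (Fin n → ℂ) :=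
    { toFun := fun X => (M X).vecMulLinear
      map_add' := fun X Y => by ext1 v; simp
      map_smul' := fun a X => by ext1 v; simp }
  have hρ' : ∀ X v, ρ X v = Matrix.vecMul v (M X) := fun X v => rfl
  have hρ : ∀ X Y v, ρ ⁅X, Y⁆ v = ρ X (ρ Y v) - ρ Y (ρ X v) := by
    intro X Y v
    simp only [hρ', hM, Matrix.vecMul_sub, Matrix.vecMul_vecMul]
  obtain ⟨b, χ, hb, hχ⟩ := exists_triangular_basis ρ hρ (by simp : Module.finrank ℂ (Fin n → ℂ) = n)
  refine ⟨χ, fun H => ?_⟩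
  obtain ⟨b', hb', hχ', hH⟩ := exists_adapted_triangular_basis ρ b hb hχ H
  refine ⟨Matrix.of fun i => b' i, fun X => Matrix.of fun i j => b'.repr (ρ X (b' i)) j, ?_, ?_,
    hb', hχ', hH⟩
  · have := (Pi.basisFun ℂ (Fin n)).isUnit_det b'
    rw [Module.Basis.det_apply, ← Matrix.det_transpose] at this
    convert this using 2
    ext i j
    simp [Module.Basis.toMatrix_apply]
  · intro X
    ext i k
    have h1 := congrFun (b'.sum_repr (ρ X (b' i))) k
    rw [Finset.sum_apply] at h1
    rw [Matrix.mul_apply, Matrix.mul_apply]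
    exact h1

section Grade

variable {p q : ℕ}

/-- A grading of the coordinates in which every monomial of degree at least `2` has larger grade
than any coordinate. -/
def coordGrade (p q : ℕ) : Fin p ⊕ Fin q → ℕ :=
  Sum.elim (fun i => p + q + 1 + i) fun j => p + q + 1 + (p + j)

theorem coordGrade_ne_zero (i : Fin p ⊕ Fin q) : coordGrade p q i ≠ 0 := by
  rcases i with i | i <;> simp [coordGrade]

theorem coordGrade_injective : Function.Injective (coordGrade p q) := by
  rintro (i | i) (j | j) h <;> simp only [coordGrade, Sum.elim_inl, Sum.elim_inr] at h
  · exact congrArg _ (Fin.ext (by omega))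
  · omega
  · omega
  · exact congrArg _ (Fin.ext (by omega))

theorem mul_degree_le_weight_coordGrade (d : Fin p ⊕ Fin q →₀ ℕ) :
    (p + q + 1) * d.degree ≤ Finsupp.weight (coordGrade p q) d := by
  rw [Finsupp.weight_eq_sum, Finsupp.degree_eq_sum, Finset.mul_sum]
  refine Finset.sum_le_sum fun i _ => ?_
  rw [smul_eq_mul, mul_comm]
  refine Nat.mul_le_mul_left _ ?_
  rcases i with i | i <;> simp [coordGrade]

theorem coordGrade_lt (i : Fin p ⊕ Fin q) : coordGrade p q i < (p + q + 1) * 2 := by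
  rcases i with i | i <;> simp only [coordGrade, Sum.elim_inl, Sum.elim_inr] <;> omega

/-- Coordinate grades lie in `[p + q + 1, 2 (p + q + 1))`, so a monomial of degree at least 2
exceeds every one of them. -/
theorem eq_zero_or_single_of_weight_le {i : Fin p ⊕ Fin q} {d : Fin p ⊕ Fin q →₀ ℕ}
    (hd : Finsupp.weight (coordGrade p q) d ≤ coordGrade p q i) :
    d = 0 ∨ ∃ j, d = Finsupp.single j 1 ∧ coordGrade p q j ≤ coordGrade p q i := by
  have h1 := mul_degree_le_weight_coordGrade d
  have h2 := coordGrade_lt i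
  have h3 : d.degree < 2 := by
    by_contra h
    have := Nat.mul_le_mul_left (p + q + 1) (not_lt.mp h)
    omega
  rcases eq_zero_or_single_of_degree_lt_two h3 with h | ⟨j, rfl⟩
  · exact Or.inl h
  · exact Or.inr ⟨j, rfl, by simpa [Finsupp.weight_single] using hd⟩

theorem sub_smul_X_mem_weightFiltration {A : FormalVF (Fin p ⊕ Fin q)} {i : Fin p ⊕ Fin q} {a : ℂ}
    (h0 : constantCoeff (A i) = 0)
    (h1 : ∀ k, coordGrade p q k < coordGrade p q i → linearPart A i k = 0)
    (h2 : linearPart A i i = a) :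
    A i - a • X i ∈ weightFiltration (coordGrade p q) (coordGrade p q i + 1) := by
  intro d hd
  rw [coeffEquiv_apply, map_sub, coeff_smul]
  rcases eq_zero_or_single_of_weight_le (Nat.le_of_lt_succ hd) with rfl | ⟨j, rfl, hj⟩
  · simp [h0]
  · rw [← linearPart_apply]
    rcases eq_or_lt_of_le hj with hj | hj
    · rw [coordGrade_injective hj, h2]
      simp
    · have hne : j ≠ i := fun h => by simp [h] at hj
      rw [h1 j hj, coeff_index_single_X, if_neg hne]
      simp

end Grade

section Normalization

variable {p q : ℕ}

/-- The monomials that may occur in a normalizing `x`-coordinate of weight `a`. -/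
def xSupport (lam : Fin p ⊕ Fin q → ℂ) (a : ℂ) : Set (Fin p ⊕ Fin q →₀ ℕ) :=
  {d | YOnly d ∨ ∃ j, d = Finsupp.single (Sum.inl j) 1 ∧ lam (Sum.inl j) = a}

/-- The monomials that may occur in a normalizing `y`-coordinate of weight `a`. -/
def ySupport (lam : Fin p ⊕ Fin q → ℂ) (a : ℂ) : Set (Fin p ⊕ Fin q →₀ ℕ) :=
  {d | YOnly d ∧ (2 ≤ d.degree ∨ ∃ j, d = Finsupp.single (Sum.inr j) 1 ∧ lam (Sum.inr j) = a)}

theorem yOnly_single_inr (j : Fin q) (n : ℕ) :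
    YOnly (Finsupp.single (Sum.inr j) n : Fin p ⊕ Fin q →₀ ℕ) := fun i => by simp

/-- Stated through x-derivatives, the support condition can be checked for `derivation A f` by
commuting `∂/∂x_i` past `A`. -/
theorem mem_coordSupported_xSupport {lam : Fin p ⊕ Fin q → ℂ} {a : ℂ}
    {f : MvPowerSeries (Fin p ⊕ Fin q) ℂ} :
    f ∈ coordSupported (coeffEquiv _) (xSupport lam a) ↔
      ∀ i, ∃ b, pderiv ℂ (Sum.inl i) f = C b ∧ (b ≠ 0 → lam (Sum.inl i) = a) := by
  classical
  constructor
  · intro h i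
    refine ⟨coeff (Finsupp.single (Sum.inl i) 1) f, ?_, fun hne => ?_⟩
    · ext d
      rw [coeff_pderiv, coeff_C]
      split_ifs with hd
      · subst hd
        simp
      · rw [show coeff (d + Finsupp.single (Sum.inl i) 1) f = 0 from h _ ?_, zero_mul]
        rintro (hy | ⟨j, hj, -⟩)
        · have := hy i
          simp at this
        · have hdeg := congrArg Finsupp.degree hj
          rw [map_add, Finsupp.degree_single, Finsupp.degree_single] at hdeg
          exact hd ((Finsupp.degree_eq_zero_iff d).mp (by omega))
    · by_contra hlam
      refine hne (h _ ?_)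
      rintro (hy | ⟨j, hj, hj'⟩)
      · have := hy i
        simp at this
      · have := (Finsupp.single_left_inj one_ne_zero).mp hj
        rw [Sum.inl.injEq] at this
        exact hlam (this ▸ hj')
  · intro h d hd
    rw [coeffEquiv_apply]
    by_contra hne
    refine hd ?_
    by_cases hy : YOnly d
    · exact Or.inl hy
    · simp only [YOnly, not_forall] at hy
      obtain ⟨i, hi⟩ := hy
      obtain ⟨b, hb, hb'⟩ := h i
      have hd' : d - Finsupp.single (Sum.inl i) 1 + Finsupp.single (Sum.inl i) 1 = d :=
        tsub_add_cancel_of_le (Finsupp.single_le_iff.mpr (Nat.one_le_iff_ne_zero.mpr hi))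
      have h3 := congrArg (coeff (d - Finsupp.single (Sum.inl i) 1)) hb
      rw [coeff_pderiv, hd', coeff_C] at h3
      have h4 : coeff d f * (((d - Finsupp.single (Sum.inl i) 1 : _ →₀ ℕ) (Sum.inl i) : ℕ) + 1 : ℂ)
          ≠ 0 := mul_ne_zero hne (Nat.cast_add_one_ne_zero _)
      rw [h3] at h4
      split_ifs at h4 with h5
      · rw [h5, zero_add] at hd'
        exact Or.inr ⟨i, hd'.symm, hb' h4⟩
      · exact absurd rfl h4

theorem mem_coordSupported_ySupport {lam : Fin p ⊕ Fin q → ℂ} {a : ℂ}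
    {f : MvPowerSeries (Fin p ⊕ Fin q) ℂ} :
    f ∈ coordSupported (coeffEquiv _) (ySupport lam a) ↔
      (∀ i, pderiv ℂ (Sum.inl i) f = 0) ∧ constantCoeff f = 0 ∧
        ∀ j, coeff (Finsupp.single (Sum.inr j) 1) f ≠ 0 → lam (Sum.inr j) = a := by
  rw [forall_pderiv_inl_eq_zero_iff]
  constructor
  · intro h
    refine ⟨fun d hd => ?_, h 0 ?_, fun j hj => ?_⟩
    · by_contra hy
      exact hd (h d fun h' => hy h'.1)
    · rintro ⟨-, h0 | ⟨j, hj, -⟩⟩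
      · simp at h0
      · exact absurd (Finsupp.single_eq_zero.mp hj.symm) one_ne_zero
    · by_contra hlam
      refine hj (h _ ?_)
      rintro ⟨-, h0 | ⟨k, hk, hk'⟩⟩
      · rw [Finsupp.degree_single] at h0
        omega
      · have := (Finsupp.single_left_inj one_ne_zero).mp hk
        rw [Sum.inr.injEq] at this
        exact hlam (this ▸ hk')
  · rintro ⟨h1, h2, h3⟩ d hd
    rw [coeffEquiv_apply]
    by_contra hne
    refine hd ⟨h1 d hne, ?_⟩
    by_cases h : 2 ≤ d.degree
    · exact Or.inl h
    · rcases eq_zero_or_single_of_degree_lt_two (not_le.mp h) with rfl | ⟨j, rfl⟩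
      · exact absurd h2 hne
      · rcases j with j | j
        · have := h1 _ hne j
          simp at this
        · exact Or.inr ⟨j, rfl, h3 j hne⟩

theorem pderiv_derivation {ι : Type*} [Fintype ι] [DecidableEq ι] (A : FormalVF ι) (i : ι)
    (f : MvPowerSeries ι ℂ) :
    pderiv ℂ i (derivation A f) =
      ∑ k, pderiv ℂ i (A k) * pderiv ℂ k f + derivation A (pderiv ℂ i f) := by
  simp only [derivation_apply, map_sum, Derivation.leibniz, smul_eq_mul, Finset.sum_add_distrib]
  rw [add_comm]
  congr 1
  · exact Finset.sum_congr rfl fun k _ => mul_comm _ _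
  · exact Finset.sum_congr rfl fun k _ => by rw [pderiv_comm]

/-- The properties of a vector field `A` that allow for its normalization: it commutes with
the `∂/∂x_i` up to constant fields, and its linear part is triangular with diagonal `lam`
and resonant within the `x`-block and within the `y`-block. -/
structure IsNormalizable (A : FormalVF (Fin p ⊕ Fin q)) (lam : Fin p ⊕ Fin q → ℂ) : Prop where
  constPart_eq_zero : constPart A = 0
  pderiv_inl_inl : ∀ i j, pderiv ℂ (Sum.inl i) (A (Sum.inl j)) =
    C (linearPart A (Sum.inl j) (Sum.inl i))
  pderiv_inl_inr : ∀ i j, pderiv ℂ (Sum.inl i) (A (Sum.inr j)) = 0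
  leading : ∀ i, A i - lam i • X i ∈ weightFiltration (coordGrade p q) (coordGrade p q i + 1)
  resonant_x : ∀ i j, linearPart A (Sum.inl i) (Sum.inl j) ≠ 0 → lam (Sum.inl j) = lam (Sum.inl i)
  resonant_y : ∀ i j, linearPart A (Sum.inr i) (Sum.inr j) ≠ 0 → lam (Sum.inr j) = lam (Sum.inr i)

namespace IsNormalizable

variable {A : FormalVF (Fin p ⊕ Fin q)} {lam : Fin p ⊕ Fin q → ℂ}

theorem pderiv_inl_derivation (h : IsNormalizable A lam) (i : Fin p)
    (f : MvPowerSeries (Fin p ⊕ Fin q) ℂ) :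
    pderiv ℂ (Sum.inl i) (derivation A f) =
      ∑ k, C (linearPart A (Sum.inl k) (Sum.inl i)) * pderiv ℂ (Sum.inl k) f +
        derivation A (pderiv ℂ (Sum.inl i) f) := by
  rw [pderiv_derivation, Fintype.sum_sum_type]
  simp [h.pderiv_inl_inl, h.pderiv_inl_inr]

theorem derivation_mem_xSupport (h : IsNormalizable A lam) {a : ℂ}
    {f : MvPowerSeries (Fin p ⊕ Fin q) ℂ}
    (hf : f ∈ coordSupported (coeffEquiv _) (xSupport lam a)) :
    derivation A f ∈ coordSupported (coeffEquiv _) (xSupport lam a) := by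
  rw [mem_coordSupported_xSupport] at hf ⊢
  choose b hb hba using hf
  intro i
  refine ⟨∑ k, linearPart A (Sum.inl k) (Sum.inl i) * b k, ?_, fun hne => ?_⟩
  · have h0 : derivation A (C (b i)) = 0 := (derivation A).map_algebraMap (b i)
    rw [h.pderiv_inl_derivation, hb, h0, add_zero, map_sum]
    exact Finset.sum_congr rfl fun k _ => by rw [hb, map_mul]
  · obtain ⟨k, -, hk⟩ := Finset.exists_ne_zero_of_sum_ne_zero hne
    rw [h.resonant_x k i (left_ne_zero_of_mul hk)]
    exact hba k (right_ne_zero_of_mul hk)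

theorem derivation_mem_ySupport (h : IsNormalizable A lam) {a : ℂ}
    {f : MvPowerSeries (Fin p ⊕ Fin q) ℂ}
    (hf : f ∈ coordSupported (coeffEquiv _) (ySupport lam a)) :
    derivation A f ∈ coordSupported (coeffEquiv _) (ySupport lam a) := by
  rw [mem_coordSupported_ySupport] at hf ⊢
  obtain ⟨h1, h2, h3⟩ := hf
  refine ⟨fun i => ?_, constantCoeff_derivation h.constPart_eq_zero f, fun j hne => ?_⟩
  · simp [h.pderiv_inl_derivation, h1]
  · rw [coeff_single_derivation h.constPart_eq_zero, Fintype.sum_sum_type] at hne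
    simp only [coeff_single_eq (Sum.inl _), h1, map_zero, zero_mul, Finset.sum_const_zero,
      zero_add] at hne
    obtain ⟨k, -, hk⟩ := Finset.exists_ne_zero_of_sum_ne_zero hne
    rw [h.resonant_y k j (right_ne_zero_of_mul hk)]
    exact h3 k (left_ne_zero_of_mul hk)

theorem isTriangularWith (h : IsNormalizable A lam) :
    IsTriangularWith (coeffEquiv _) (Finsupp.weight (coordGrade p q))
      (derivation A : Module.End ℂ _) (Finsupp.weight lam) :=
  isTriangularWith_derivation h.leading

theorem exists_generalized_eigenvector (h : IsNormalizable A lam) (i : Fin p ⊕ Fin q)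
    (K : Set (Fin p ⊕ Fin q →₀ ℕ))
    (hK : ∀ f ∈ coordSupported (coeffEquiv _) K, derivation A f ∈ coordSupported (coeffEquiv _) K)
    (hi : Finsupp.single i 1 ∈ K) :
    ∃ f : MvPowerSeries (Fin p ⊕ Fin q) ℂ,
      f - X i ∈ coordSupported (coeffEquiv _) K ∧
      f - X i ∈ weightFiltration (coordGrade p q) (coordGrade p q i + 1) ∧
      (∀ d, coeff d (f - X i) ≠ 0 → Finsupp.weight lam d ≠ lam i) ∧
      f ∈ filteredEigenspace (coeffEquiv _) (Finsupp.weight (coordGrade p q))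
        (derivation A : Module.End ℂ _) (lam i) := by
  have hXK : (X i : MvPowerSeries (Fin p ⊕ Fin q) ℂ) ∈ coordSupported (coeffEquiv _) K := by
    intro d hd
    rw [coeffEquiv_apply, coeff_X, if_neg]
    rintro rfl
    exact hd hi
  obtain ⟨f, h1, h2, h3, h4⟩ := h.isTriangularWith.exists_generalized_eigenvector K hK
    (X_mem_weightFiltration i) hXK (a := lam i) (by
      intro d _ hd
      rw [coeffEquiv_apply, coeff_X] at hd
      split_ifs at hd with hdi
      · simp [hdi, Finsupp.weight_single]
      · exact absurd rfl hd)
  exact ⟨f, Submodule.sub_mem _ h1 hXK, h2, h3,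
    fun s => ⟨s, gradeFiltration_antitone (Nat.le_add_left _ _) (h4 s)⟩⟩

/-- **Poincaré–Dulac normalization** of a single vector field by a map `I + V`, with `V`
depending only on `y`: the components of the map are generalized eigenvectors. -/
theorem exists_normalizing_map (h : IsNormalizable A lam) :
    ∃ φ : FormalVF (Fin p ⊕ Fin q), IsYShift φ ∧
      (∀ j, φ (Sum.inr j) - X (Sum.inr j) ∈ weightFiltration (fun _ => 1) 2) ∧
      (∀ i, φ i - X i ∈ weightFiltration (coordGrade p q) (coordGrade p q i + 1)) ∧
      ∀ i, φ i ∈ filteredEigenspace (coeffEquiv _) (Finsupp.weight (coordGrade p q))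
        (derivation A : Module.End ℂ _) (lam i) := by
  have hx := fun i : Fin p => h.exists_generalized_eigenvector (Sum.inl i)
    (xSupport lam (lam (Sum.inl i))) (fun f => h.derivation_mem_xSupport) (Or.inr ⟨i, rfl, rfl⟩)
  have hy := fun j : Fin q => h.exists_generalized_eigenvector (Sum.inr j)
    (ySupport lam (lam (Sum.inr j))) (fun f => h.derivation_mem_ySupport)
    ⟨yOnly_single_inr j 1, Or.inr ⟨j, rfl, rfl⟩⟩
  choose fx hx1 hx2 hx3 hx4 using hx
  choose fy hy1 hy2 hy3 hy4 using hy
  refine ⟨Sum.elim fx fy, ?_, fun j => ?_, ?_, ?_⟩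
  · intro i k
    rw [← sub_eq_zero, ← map_sub]
    rcases k with k | k
    · refine forall_pderiv_inl_eq_zero_iff.mpr (fun d hd => ?_) i
      by_contra hdy
      refine hd (hx1 k d ?_)
      -- The only admissible monomials involving `x` have weight equal to the eigenvalue, and such
      -- monomials do not occur in a correction.
      rintro (hd' | ⟨j, rfl, hj⟩)
      · exact hdy hd'
      · refine hx3 k _ hd ?_
        simpa [Finsupp.weight_single] using hj
    · exact (mem_coordSupported_ySupport.mp (hy1 k)).1 i
  · obtain ⟨h1, h2, h3⟩ := mem_coordSupported_ySupport.mp (hy1 j)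
    refine mem_weightFiltration_one_two h2 fun k => ?_
    rcases k with k | k
    · rw [coeff_single_eq]
      exact (congrArg _ (h1 k)).trans (map_zero _)
    -- Likewise an admissible linear y-monomial has the excluded weight, so the correction starts in
    -- degree 2.
    · by_contra hne
      refine hy3 j _ hne ?_
      simpa [Finsupp.weight_single] using h3 k hne
  · rintro (i | i)
    · exact hx2 i
    · exact hy2 i
  · rintro (i | i)
    · exact hx4 i
    · exact hy4 i

end IsNormalizable

/-- The linear part is block upper triangular with identity diagonal blocks. -/
theorem isFormalChange_of_isYShift {φ : FormalVF (Fin p ⊕ Fin q)} (hφ : constPart φ = 0)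
    (hshift : IsYShift φ)
    (hy : ∀ j, φ (Sum.inr j) - X (Sum.inr j) ∈ weightFiltration (fun _ => 1) 2) :
    IsFormalChange φ := by
  refine ⟨hφ, ?_⟩
  change IsUnit (linearPart φ).det
  have h11 : (linearPart φ).toBlocks₁₁ = 1 := by
    ext i j
    rw [Matrix.toBlocks₁₁, Matrix.of_apply, linearPart_apply, coeff_single_eq, hshift,
      ← coeff_single_eq, coeff_index_single_X, Matrix.one_apply]
    simp [eq_comm]
  have h21 : (linearPart φ).toBlocks₂₁ = 0 := by
    ext i j
    rw [Matrix.toBlocks₂₁, Matrix.of_apply, linearPart_apply, coeff_single_eq, hshift,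
      ← coeff_single_eq, coeff_index_single_X]
    simp
  have h22 : (linearPart φ).toBlocks₂₂ = 1 := by
    ext i j
    have := hy i (Finsupp.single (Sum.inr j) 1) (by simp [Finsupp.weight_single])
    rw [coeffEquiv_apply, map_sub, sub_eq_zero] at this
    rw [Matrix.toBlocks₂₂, Matrix.of_apply, linearPart_apply, this, coeff_index_single_X,
      Matrix.one_apply]
    simp [eq_comm]
  rw [← Matrix.fromBlocks_toBlocks (linearPart φ), h21, Matrix.det_fromBlocks_zero₂₁, h11, h22]
  simp

section Transforms

variable {ι : Type*} [Fintype ι] {φ A B : FormalVF ι}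

theorem Transforms.constPart_eq_zero (h : Transforms φ A B) (hφ : constPart φ = 0)
    (hA : constPart A = 0) : constPart B = 0 := by
  ext i
  have h1 := congrArg constantCoeff (congrFun h i)
  rw [star_apply, constantCoeff_derivation hA, comp, constantCoeff_subst_eq hφ] at h1
  exact h1.symm

theorem Transforms.linearPart_mul (h : Transforms φ A B) (hφ : constPart φ = 0)
    (hA : constPart A = 0) : linearPart B * linearPart φ = linearPart φ * linearPart A := by
  ext i k
  have h1 := congrArg (coeff (Finsupp.single k 1)) (congrFun h i)
  rw [star_apply, coeff_single_derivation hA, comp, coeff_single_subst hφ] at h1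
  exact h1.symm

end Transforms

end Normalization

end FormalVF

/-! ### Resonance from a generic element, and assembly of the normal form. -/

namespace FormalVF

open MvPowerSeries

section Resonance

variable {p q : ℕ} {r : Type*} [LieRing r] [LieAlgebra ℂ r]

/-- If the coordinates are generalized eigenvectors of `R H`, then the components of the vector
fields `R X`, for `X` in a generalized eigenspace of `ad H`, are weight vectors. -/
theorem weight_eq_of_generalized_eigenvector {R : r →ₗ[ℂ] FormalVF (Fin p ⊕ Fin q)}
    (hR : IsNonlinearRep R) {wt : r → Fin p ⊕ Fin q → ℂ}
    (htri : ∀ X, IsTriangularWith (coeffEquiv _) (Finsupp.weight (coordGrade p q))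
      (derivation (R X) : Module.End ℂ _) (Finsupp.weight (wt X))) {H : r}
    (hX : ∀ i, X i ∈ filteredEigenspace (coeffEquiv _) (Finsupp.weight (coordGrade p q))
      (derivation (R H) : Module.End ℂ _) (wt H i)) {a : ℂ} {Y : r}
    (hY : Y ∈ Module.End.maxGenEigenspace (LieAlgebra.ad ℂ r H) a) {i : Fin p ⊕ Fin q}
    {d : Fin p ⊕ Fin q →₀ ℕ} (hd : coeff d (R Y i) ≠ 0) :
    Finsupp.weight (wt H) d = a + wt H i := by
  classical
  have hmem : R Y i ∈ filteredEigenspace (coeffEquiv _) (Finsupp.weight (coordGrade p q))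
      (derivation (R H) : Module.End ℂ _) (a + wt H i) := by
    intro s
    obtain ⟨n, hn⟩ := Module.End.mem_maxGenEigenspace _ _ _ |>.mp hY
    obtain ⟨k, hk⟩ := hX i s
    refine ⟨n + k, ?_⟩
    -- The representation identity is a Leibniz rule for `(Y, f) ↦ R_Y f`. The submodule for `Y` is
    -- `⊥` because a power of `ad H - a` kills `Y` exactly, whereas `X i` is only driven deep into
    -- the filtration.
    have := pow_apply_mem_of_leibniz (fun (Y : r) (f : MvPowerSeries (Fin p ⊕ Fin q) ℂ) =>
        derivation (R Y) f)
      (dA := (LieAlgebra.ad ℂ r H : Module.End ℂ r) - algebraMap ℂ (Module.End ℂ r) a)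
      (dB := (derivation (R H) : Module.End ℂ _) - algebraMap ℂ (Module.End ℂ _) (wt H i))
      (dC := (derivation (R H) : Module.End ℂ _) - algebraMap ℂ (Module.End ℂ _) (a + wt H i))
      (N := weightFiltration (coordGrade p q) s) (NA := ⊥)
      (NB := weightFiltration (coordGrade p q) s) ?_
      (fun z hz => ((htri H).sub_algebraMap _).mapsTo hz) ?_
      (fun Y f hf => (htri Y).mapsTo hf) n k Y (X i)
      (by simpa [Algebra.algebraMap_eq_smul_one] using hn) hk
    · rwa [derivation_X] at this
    · intro Y f
      simp only [LinearMap.sub_apply, Derivation.coeFn_coe, Module.algebraMap_end_apply,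
        LieAlgebra.ad_apply, map_sub, map_smul, derivation_sub, derivation_smul, hR H Y,
        derivation_bracket, add_smul]
      rw [show derivation (R Y) (wt H i • f) = wt H i • derivation (R Y) f from
        Derivation.map_smul _ _ _]
      abel
    · intro Y hY f
      rw [Submodule.mem_bot] at hY
      have : derivation (R Y) f = 0 := by
        rw [hY, map_zero, derivation_apply]
        simp
      rw [this]
      exact Submodule.zero_mem _
  refine (htri H).weight_eq_of_mem_filteredEigenspace
    (fun s => Finsupp.finite_of_nat_weight_lt _ coordGrade_ne_zero s) (fun m => ?_) hmem hd
  rw [coeffEquiv_symm_single]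
  exact monomial_mem_filteredEigenspace (htri H) hX m

/-- The normal form criterion: a representation acting triangularly, for which the coordinates are
generalized eigenvectors of a generic element, contains only resonant monomials. -/
theorem isResonant_of_generic [FiniteDimensional ℂ r] {R : r →ₗ[ℂ] FormalVF (Fin p ⊕ Fin q)}
    (hR : IsNonlinearRep R) {wt : Fin p ⊕ Fin q → Module.Dual ℂ r}
    (htri : ∀ X, IsTriangularWith (coeffEquiv _) (Finsupp.weight (coordGrade p q))
      (derivation (R X) : Module.End ℂ _) (Finsupp.weight fun i => wt i X)) {n : ℕ}
    {χ : Fin n → Module.Dual ℂ r} (hroot : ∀ k, IsLieRoot (χ k)) {H : r}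
    (heig : ∀ a, Module.End.HasEigenvalue (LieAlgebra.ad ℂ r H) a → ∃ k, χ k H = a)
    (hgen : ∀ (d : Fin p ⊕ Fin q →₀ ℕ) i k, (∑ j, (d j : ℂ) • wt j) - wt i - χ k ≠ 0 →
      ((∑ j, (d j : ℂ) • wt j) - wt i - χ k) H ≠ 0)
    (hX : ∀ i, X i ∈ filteredEigenspace (coeffEquiv _) (Finsupp.weight (coordGrade p q))
      (derivation (R H) : Module.End ℂ _) (wt i H)) (Y : r) (i : Fin p ⊕ Fin q)
    (d : Fin p ⊕ Fin q →₀ ℕ) (hd : coeff d (R Y i) ≠ 0) : IsResonant wt d i := by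
  -- Resonance is tested on generalized eigenvectors of `ad H`, which span `r`; a coefficient that
  -- is nonzero on a sum is nonzero on a summand.
  have htop : Y ∈ ⨆ a, Module.End.maxGenEigenspace (LieAlgebra.ad ℂ r H) a := by
    rw [Module.End.iSup_maxGenEigenspace_eq_top]
    trivial
  revert hd
  refine Submodule.iSup_induction _ (motive := fun Y => coeff d (R Y i) ≠ 0 → IsResonant wt d i)
    htop ?_ (by simp) ?_
  · intro a Y hY hd
    have hw := weight_eq_of_generalized_eigenvector hR (wt := fun X i => wt i X) htri hX hY hd
    have hY0 : Y ≠ 0 := fun h => by simp [h] at hd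
    have ha : Module.End.HasEigenvalue (LieAlgebra.ad ℂ r H) a := by
      have hne : Module.End.maxGenEigenspace (LieAlgebra.ad ℂ r H) a ≠ ⊥ := fun h => by
        rw [h, Submodule.mem_bot] at hY
        exact hY0 hY
      obtain ⟨l, hl⟩ := Module.End.mem_maxGenEigenspace _ _ _ |>.mp hY
      refine Module.End.hasEigenvalue_of_hasGenEigenvalue (k := l) ?_
      intro h
      have : Y ∈ Module.End.genEigenspace (LieAlgebra.ad ℂ r H) a l :=
        Module.End.mem_genEigenspace_nat.mpr hl
      rw [h, Submodule.mem_bot] at this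
      exact hY0 this
    obtain ⟨k, hk⟩ := heig a ha
    -- This form vanishes at `H`, hence identically, since `H` is generic.
    have hform : (∑ j, (d j : ℂ) • wt j) - wt i - χ k = 0 := by
      by_contra hne
      refine hgen d i k hne ?_
      rw [Finsupp.weight_eq_sum] at hw
      simp only [nsmul_eq_mul] at hw
      simp only [LinearMap.sub_apply, LinearMap.sum_apply, LinearMap.smul_apply, smul_eq_mul, hw,
        hk]
      ring
    rw [IsResonant, sub_eq_zero.mp hform]
    exact hroot k
  · intro Y Z hY hZ hd
    by_cases h : coeff d (R Y i) = 0
    · refine hZ fun h' => hd ?_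
      rw [map_add, Pi.add_apply, map_add, h, h', add_zero]
    · exact hY h

end Resonance

section Main

variable {p q : ℕ} {g : Type*} [LieRing g] [LieAlgebra ℂ g] {m : LieIdeal ℂ g}
  {T : g →ₗ[ℂ] FormalVF (Fin p ⊕ Fin q)}

theorem MapsOntoXFields.of_transforms {S : g →ₗ[ℂ] FormalVF (Fin p ⊕ Fin q)}
    {φ : FormalVF (Fin p ⊕ Fin q)} (hm : MapsOntoXFields m T) (htr : ∀ X, Transforms φ (T X) (S X))
    (hφ : constPart φ = 0)
    (hinj : Function.Injective (subst φ : MvPowerSeries (Fin p ⊕ Fin q) ℂ →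
      MvPowerSeries (Fin p ⊕ Fin q) ℂ)) {M : Matrix (Fin p) (Fin p) ℂ} (hM : IsUnit M.det)
    (hstar : ∀ a, star φ (xField q a) = xField q (M.mulVec a)) : MapsOntoXFields m S := by
  have hs := hasSubst_of_constPart hφ
  have key : ∀ X a, T X = xField q a → S X = xField q (M.mulVec a) := fun X a h =>
    Transforms.eq_xField (h ▸ htr X) hs hinj (hstar a)
  constructor
  · intro X hX
    obtain ⟨a, ha⟩ := hm.1 X hX
    exact ⟨_, key X a ha⟩
  · intro a
    obtain ⟨X, hX, hTX⟩ := hm.2 (M⁻¹.mulVec a)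
    refine ⟨X, hX, ?_⟩
    rw [key X _ hTX, Matrix.mulVec_mulVec, Matrix.mul_nonsing_inv _ hM, Matrix.one_mulVec]

theorem toBlocks₁₁_mul_of_toBlocks₂₁ {A B : Matrix (Fin p ⊕ Fin q) (Fin p ⊕ Fin q) ℂ}
    (hB : ∀ i j, B (Sum.inr i) (Sum.inl j) = 0) :
    (A * B).toBlocks₁₁ = A.toBlocks₁₁ * B.toBlocks₁₁ := by
  ext i j
  simp [Matrix.toBlocks₁₁, Matrix.mul_apply, hB]

theorem toBlocks₂₂_mul_of_toBlocks₂₁ {A B : Matrix (Fin p ⊕ Fin q) (Fin p ⊕ Fin q) ℂ}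
    (hA : ∀ i j, A (Sum.inr i) (Sum.inl j) = 0) :
    (A * B).toBlocks₂₂ = A.toBlocks₂₂ * B.toBlocks₂₂ := by
  ext i j
  simp [Matrix.toBlocks₂₂, Matrix.mul_apply, hA]

theorem leading_of_linearPart (hT : IsNonlinearRep T) (hm : MapsOntoXFields m T) {X : g}
    (h0 : constPart (T X) = 0) {lam : Fin p ⊕ Fin q → ℂ}
    (hx : ∀ i j, j < i → linearPart (T X) (Sum.inl i) (Sum.inl j) = 0)
    (hy : ∀ i j, j < i → linearPart (T X) (Sum.inr i) (Sum.inr j) = 0)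
    (hdiag : ∀ i, linearPart (T X) i i = lam i) (i : Fin p ⊕ Fin q) :
    T X i - lam i • MvPowerSeries.X i ∈
      weightFiltration (coordGrade p q) (coordGrade p q i + 1) := by
  refine sub_smul_X_mem_weightFiltration (congrFun h0 i) (fun k hk => ?_) (hdiag i)
  rcases i with i | i <;> rcases k with k | k <;>
    simp only [coordGrade, Sum.elim_inl, Sum.elim_inr] at hk
  · exact hx i k (by omega)
  · omega
  · exact hm.linearPart_inr_inl hT X k i
  · exact hy i k (by omega)

/-- Normalization of a nonlinear representation along a solvable Lie algebra `r` of elements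
without constant term. -/
theorem exists_normal_form {r : Type*} [LieRing r] [LieAlgebra ℂ r] [LieAlgebra.IsSolvable r]
    [FiniteDimensional ℂ r] (ψ : r →ₗ⁅ℂ⁆ g) (hT : IsNonlinearRep T) (hm : MapsOntoXFields m T)
    (h0 : ∀ X, constPart (T (ψ X)) = 0) :
    ∃ (P : Matrix (Fin p) (Fin p) ℂ) (Q : Matrix (Fin q) (Fin q) ℂ)
      (S : g →ₗ[ℂ] FormalVF (Fin p ⊕ Fin q)),
      IsUnit P.det ∧ IsUnit Q.det ∧ IsEquivalence (linearChange P Q) T S ∧ MapsOntoXFields m S ∧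
      ∃ (W : ℕ → FormalVF (Fin p ⊕ Fin q)) (φ : FormalVF (Fin p ⊕ Fin q))
        (T' : g →ₗ[ℂ] FormalVF (Fin p ⊕ Fin q)) (wt : Fin p ⊕ Fin q → Module.Dual ℂ r),
        (∀ k, 1 ≤ k → IsHomogeneous k (W k) ∧ DependsOnlyOnY (W k)) ∧
        (∀ j : Fin q, W 1 (Sum.inr j) = 0) ∧
        IsInfiniteComp W φ ∧ IsEquivalence φ S T' ∧ IsNormalForm (fun X => T' (ψ X)) wt := by
  let L : r → Matrix (Fin p ⊕ Fin q) (Fin p ⊕ Fin q) ℂ := fun X => linearPart (T (ψ X))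
  have hL21 : ∀ X i j, L X (Sum.inr i) (Sum.inl j) = 0 := fun X i j =>
    hm.linearPart_inr_inl hT (ψ X) j i
  have hLlie : ∀ X Y, L ⁅X, Y⁆ = L Y * L X - L X * L Y := fun X Y => by
    simp only [L]
    rw [LieHom.map_lie, hT, linearPart_bracket (h0 X) (h0 Y)]
  let Mx : r →ₗ[ℂ] Matrix (Fin p) (Fin p) ℂ :=
    { toFun := fun X => (L X).toBlocks₁₁
      map_add' := fun X Y => by ext i j; simp [L, Matrix.toBlocks₁₁, linearPart_apply]
      map_smul' := fun a X => by ext i j; simp [L, Matrix.toBlocks₁₁, linearPart_apply] }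
  let My : r →ₗ[ℂ] Matrix (Fin q) (Fin q) ℂ :=
    { toFun := fun X => (L X).toBlocks₂₂
      map_add' := fun X Y => by ext i j; simp [L, Matrix.toBlocks₂₂, linearPart_apply]
      map_smul' := fun a X => by ext i j; simp [L, Matrix.toBlocks₂₂, linearPart_apply] }
  have hMx : ∀ X Y, Mx ⁅X, Y⁆ = Mx Y * Mx X - Mx X * Mx Y := fun X Y => by
    change (L ⁅X, Y⁆).toBlocks₁₁ = _
    rw [hLlie]
    change (L Y * L X).toBlocks₁₁ - (L X * L Y).toBlocks₁₁ = _
    rw [toBlocks₁₁_mul_of_toBlocks₂₁ (hL21 X), toBlocks₁₁_mul_of_toBlocks₂₁ (hL21 Y)]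
    rfl
  have hMy : ∀ X Y, My ⁅X, Y⁆ = My Y * My X - My X * My Y := fun X Y => by
    change (L ⁅X, Y⁆).toBlocks₂₂ = _
    rw [hLlie]
    change (L Y * L X).toBlocks₂₂ - (L X * L Y).toBlocks₂₂ = _
    rw [toBlocks₂₂_mul_of_toBlocks₂₁ (hL21 X), toBlocks₂₂_mul_of_toBlocks₂₁ (hL21 Y)]
    rfl
  obtain ⟨μ, hμ⟩ := exists_triangular_conjugates Mx hMx
  obtain ⟨ν, hν⟩ := exists_triangular_conjugates My hMy
  obtain ⟨n, χ, hroot, heig⟩ := exists_lieRoots (r := r)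
  let wt : Fin p ⊕ Fin q → Module.Dual ℂ r := Sum.elim μ ν
  -- Exponents, components and roots form a countable index set, so one `H` serves for all monomials
  -- at once.
  obtain ⟨H, hH⟩ := exists_forall_dual_apply_ne_zero
    (fun x : (Fin p ⊕ Fin q →₀ ℕ) × (Fin p ⊕ Fin q) × Fin n =>
      (∑ j, (x.1 j : ℂ) • wt j) - wt x.2.1 - χ x.2.2)
  obtain ⟨P, Nx, hP, hPN, hNx, hNxd, hNxH⟩ := hμ H
  obtain ⟨Q, Ny, hQ, hQN, hNy, hNyd, hNyH⟩ := hν H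
  have hc := isFormalChange_linearChange hP hQ
  have hLbij := bijective_subst_linearChange hP hQ
  obtain ⟨S, hTS⟩ := exists_isEquivalence hT hc hLbij
  have hS := hTS.2.1
  have hmS : MapsOntoXFields m S :=
    hm.of_transforms hTS.2.2 hc.1 hLbij.1 hP star_linearChange_xField
  have hS0 : ∀ X, constPart (S (ψ X)) = 0 := fun X =>
    (hTS.2.2 (ψ X)).constPart_eq_zero hc.1 (h0 X)
  have hSlin : ∀ X, linearPart (S (ψ X)) * Matrix.fromBlocks P 0 0 Q =
      Matrix.fromBlocks P 0 0 Q * L X := fun X => by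
    have := (hTS.2.2 (ψ X)).linearPart_mul hc.1 (h0 X)
    rwa [linearPart_linearChange] at this
  have hSx : ∀ X i j, linearPart (S (ψ X)) (Sum.inl i) (Sum.inl j) = Nx X i j := by
    intro X
    have h1 := congrArg Matrix.toBlocks₁₁ (hSlin X)
    rw [toBlocks₁₁_mul_of_toBlocks₂₁ (by simp), toBlocks₁₁_mul_of_toBlocks₂₁ (hL21 X),
      Matrix.toBlocks_fromBlocks₁₁] at h1
    have h2 := (h1.trans (hPN X).symm)
    have h3 := ((Matrix.isUnit_iff_isUnit_det P).mpr hP).mul_right_cancel h2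
    intro i j
    exact congrFun (congrFun h3 i) j
  have hSy : ∀ X i j, linearPart (S (ψ X)) (Sum.inr i) (Sum.inr j) = Ny X i j := by
    intro X
    have h1 := congrArg Matrix.toBlocks₂₂ (hSlin X)
    rw [toBlocks₂₂_mul_of_toBlocks₂₁ (fun i j => hmS.linearPart_inr_inl hS (ψ X) j i),
      toBlocks₂₂_mul_of_toBlocks₂₁ (by simp), Matrix.toBlocks_fromBlocks₂₂] at h1
    have h2 := (h1.trans (hQN X).symm)
    have h3 := ((Matrix.isUnit_iff_isUnit_det Q).mpr hQ).mul_right_cancel h2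
    intro i j
    exact congrFun (congrFun h3 i) j
  have hlead : ∀ X i, S (ψ X) i - wt i X • MvPowerSeries.X i ∈
      weightFiltration (coordGrade p q) (coordGrade p q i + 1) := by
    intro X
    refine leading_of_linearPart hS hmS (hS0 X) (lam := fun i => wt i X)
      (fun i j hij => by rw [hSx, hNx X i j hij]) (fun i j hij => by rw [hSy, hNy X i j hij]) ?_
    rintro (i | i)
    · rw [hSx, hNxd]; rfl
    · rw [hSy, hNyd]; rfl
  have hnorm : IsNormalizable (S (ψ H)) (fun i => wt i H) :=
    { constPart_eq_zero := hS0 H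
      pderiv_inl_inl := fun i j => hmS.pderiv_inl_inl hS (ψ H) i j
      pderiv_inl_inr := fun i j => hmS.pderiv_inl_inr hS (ψ H) i j
      leading := hlead H
      resonant_x := fun i j h => hNxH i j (by rwa [hSx] at h)
      resonant_y := fun i j h => hNyH i j (by rwa [hSy] at h) }
  obtain ⟨φ, hshift, hφy, hφlead, hφeig⟩ := hnorm.exists_normalizing_map
  have hφ0 : constPart φ = 0 := by
    ext i
    have h1 := hφlead i 0 (by simp)
    rw [coeffEquiv_apply, map_sub, coeff_zero_X, sub_zero] at h1
    exact h1
  have hφs := hasSubst_of_constPart hφ0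
  have hφtri := isTriangularWith_substLinear hφs hφlead
  have hφbij : Function.Bijective (subst φ : MvPowerSeries (Fin p ⊕ Fin q) ℂ →
      MvPowerSeries (Fin p ⊕ Fin q) ℂ) := by
    convert hφtri.bijective using 1
    ext1 f
    exact (substLinear_apply hφs f).symm
  obtain ⟨W, hW, hW1, hWφ⟩ := exists_isInfiniteComp hφ0 hshift hφy
  obtain ⟨T', hST'⟩ := exists_isEquivalence hS (isFormalChange_of_isYShift hφ0 hshift hφy) hφbij
  have hmT' : MapsOntoXFields m T' :=
    hmS.of_transforms hST'.2.2 hφ0 hφbij.1 (M := 1) (by simp) fun a => by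
      rw [hshift.star_xField, Matrix.one_mulVec]
  have hconj : ∀ X f, substLinear hφs ((derivation (T' (ψ X)) : Module.End ℂ _) f) =
      (derivation (S (ψ X)) : Module.End ℂ _) (substLinear hφs f) := by
    intro X f
    simp only [substLinear_apply, Derivation.coeFn_coe]
    exact ((hST'.2.2 (ψ X)).derivation_subst hφ0 f).symm
  have htri : ∀ X, IsTriangularWith (coeffEquiv _) (Finsupp.weight (coordGrade p q))
      (derivation (T' (ψ X)) : Module.End ℂ _) (Finsupp.weight fun i => wt i X) := fun X =>
    (isTriangularWith_derivation (hlead X)).conj hφtri (hconj X)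
  -- Triangularity of the derivation, applied to the coordinate function `X i`, yields the low-grade
  -- coefficients of the field: zeros below the diagonal and the weight on it.
  have hcoeff : ∀ X i d, Finsupp.weight (coordGrade p q) d ≤ coordGrade p q i →
      coeff d (T' (ψ X) i) = Finsupp.weight (fun i => wt i X) d * coeff d (MvPowerSeries.X i) := by
    intro X i d hd
    rw [← derivation_X (T' (ψ X)) i]
    exact htri X _ _ (X_mem_weightFiltration i) d hd
  have hcoeff1 : ∀ X i k, coordGrade p q k < coordGrade p q i →
      coeff (Finsupp.single k 1) (T' (ψ X) i) = 0 := by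
    intro X i k hk
    have hne : k ≠ i := fun h => by simp [h] at hk
    rw [hcoeff X i _ (by simpa [Finsupp.weight_single] using hk.le), coeff_index_single_X,
      if_neg hne, mul_zero]
  refine ⟨P, Q, S, hP, hQ, hTS, hmS, W, φ, T', wt, hW, hW1, hWφ, hST', ?_⟩
  refine
    { constPart_eq_zero := fun X => (hST'.2.2 (ψ X)).constPart_eq_zero hφ0 (hS0 X)
      x_shape := fun X => hmT'.x_shape hST'.2.1 (ψ X)
      y_shape := fun X => hmT'.y_shape hST'.2.1 (ψ X)
      x_triangular := fun X i j hij => hcoeff1 X _ _ ?_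
      y_triangular := fun X i j hij => hcoeff1 X _ _ ?_
      diagonal := fun X i => ?_
      resonant := ?_ }
  · simpa [coordGrade] using hij
  · simpa [coordGrade] using hij
  · rw [hcoeff X i _ (by simp [Finsupp.weight_single]), coeff_index_single_self_X,
      Finsupp.weight_single]
    simp
  · refine isResonant_of_generic (R := T' ∘ₗ (ψ : r →ₗ[ℂ] g)) (fun X Y => ?_) htri hroot
      (heig H) (fun d i k => hH (d, i, k)) fun i => ?_
    · simp [hST'.2.1 (ψ X) (ψ Y)]
    -- Substituting `φ` into `X i` gives `φ i`, a generalized eigenvector for `S` at `H`;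
    -- conjugation carries this back to `X i` for `T'`.
    · refine hφtri.mem_filteredEigenspace_of_conj (hconj H) ?_
      rw [substLinear_apply, subst_X hφs]
      exact hφeig i

end Main

end FormalVF
open FormalVF in
/-- The ambient hypotheses: `T` is a nonlinear representation of `g = g₀ + m` with `m` an abelian
ideal of dimension `p`, `T⁰` vanishes on `g₀` and nowhere on `m ∖ {0}`, and the coordinates
`(x_1, …, x_p, y_1, …, y_q)` are such that `T_X = ∑ a_i(X) ∂/∂x_i` for `X ∈ m`. -/
theorem proposition4p8 {g : Type*} [LieRing g] [LieAlgebra ℂ g] [FiniteDimensional ℂ g]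
    (g₀ : LieSubalgebra ℂ g) (m : LieIdeal ℂ g) (hab : IsLieAbelian m)
    (hsum : ∀ Z : g, ∃ X ∈ g₀, ∃ Y ∈ m, Z = X + Y)
    (p q : ℕ) (hp : Module.finrank ℂ m = p)
    (T : g →ₗ[ℂ] FormalVF (Fin p ⊕ Fin q)) (hT : IsNonlinearRep T)
    (hT₀ : ∀ X ∈ g₀, constPart (T X) = 0)
    (hTm : ∀ X ∈ m, X ≠ 0 → constPart (T X) ≠ 0)
    (a : Fin p → Module.Dual ℂ m)
    (hcoord : ∀ X : m, T X = ∑ i, a i X • coordField (Sum.inl i)) :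
    ∃ (P : Matrix (Fin p) (Fin p) ℂ) (Q : Matrix (Fin q) (Fin q) ℂ)
      (S : g →ₗ[ℂ] FormalVF (Fin p ⊕ Fin q)),
      -- `S` is the representation `T` written in the coordinates `(P x, Q y)`
      IsUnit P.det ∧ IsUnit Q.det ∧ IsEquivalence (linearChange P Q) T S ∧
      -- a normalizing operator that is an infinite composition of the required kind
      (∃ (W : ℕ → FormalVF (Fin p ⊕ Fin q)) (φ : FormalVF (Fin p ⊕ Fin q))
        (T' : g →ₗ[ℂ] FormalVF (Fin p ⊕ Fin q))
        (wt : Fin p ⊕ Fin q → Module.Dual ℂ (LieAlgebra.radical ℂ g₀)),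
        (∀ k, 1 ≤ k → IsHomogeneous k (W k) ∧ DependsOnlyOnY (W k)) ∧
        (∀ j : Fin q, W 1 (Sum.inr j) = 0) ∧
        IsInfiniteComp W φ ∧
        IsEquivalence φ S T' ∧
        IsNormalForm (fun X : LieAlgebra.radical ℂ g₀ => T' ((X : g₀) : g)) wt) ∧
      -- every infinite composition of this kind leaves the restriction to `m` invariant
      (∀ (W : ℕ → FormalVF (Fin p ⊕ Fin q)) (φ : FormalVF (Fin p ⊕ Fin q)),
        (∀ k, 1 ≤ k → IsHomogeneous k (W k) ∧ DependsOnlyOnY (W k)) →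
        IsInfiniteComp W φ →
        (∀ X ∈ m, Transforms φ (S X) (S X)) ∧
        ∀ i : Fin p, Transforms φ (coordField (Sum.inl i)) (coordField (Sum.inl i))) := by
  have hfin : FiniteDimensional ℂ m := inferInstance
  let A : m →ₗ[ℂ] (Fin p → ℂ) := LinearMap.pi a
  have hTA : ∀ X : m, T X = xField q (A X) := fun X => by
    rw [hcoord, ← sum_smul_coordField]
    rfl
  -- On `m` the constant part of `T` is `A`, which is injective as `T⁰` has no zeros on `m ∖ {0}`;
  -- equality of dimensions then makes it surjective.
  have hA : Function.Injective A := by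
    rw [injective_iff_map_eq_zero]
    intro X hX
    by_contra hne
    refine hTm X X.2 (fun h => hne (Subtype.ext h)) ?_
    rw [hTA, hX]
    ext i
    rcases i with i | i <;> simp [constPart]
  have hA' : Function.Surjective A :=
    (LinearMap.injective_iff_surjective_of_finrank_eq_finrank (by simpa using hp)).mp hA
  have hm : MapsOntoXFields m T := by
    refine ⟨fun X hX => ⟨_, hTA ⟨X, hX⟩⟩, fun b => ?_⟩
    obtain ⟨X, rfl⟩ := hA' b
    exact ⟨X, X.2, hTA X⟩
  obtain ⟨P, Q, S, hP, hQ, hTS, hmS, h⟩ := exists_normal_form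
    (g₀.incl.comp (LieAlgebra.radical ℂ g₀).incl) hT hm (fun X => hT₀ _ (X : g₀).2)
  refine ⟨P, Q, S, hP, hQ, hTS, h, fun W φ hW hφ => ?_⟩
  obtain ⟨h0, hshift⟩ := hφ.constPart_eq_zero_and_isYShift hW
  refine ⟨fun X hX => ?_, fun i => ?_⟩
  · obtain ⟨b, hb⟩ := hmS.1 X hX
    rw [hb]
    exact hshift.transforms_xField h0 b
  · rw [coordField_inl]
    exact hshift.transforms_xField h0 _
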